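/- Let $\Omega\subset\mathbb{R}^2$ be a bounded Lipschitz domain, divided into $n$ non-overlapping polygonal subdomains $\Omega_1,\dots,\Omega_n$: the $\Omega_i\subseteq\Omega$ are pairwise disjoint, $\overline\Omega=\bigcup_i\overline{\Omega_i}$, and each $\Omega_i$ is a bounded connected open set that is the interior of its closure and whose boundary is a finite union of line segments. Let $\Gamma_i=\partial\Omega_i$ and $\Gamma=\bigcup_i\Gamma_i$. Let $K\in L^\infty(\Omega)^{2\times 2}$ have positive definite values almost everywhere, let $f\in L^2(\Omega)$, and let $g$ be a function on $\partial\Omega$. Write $(\cdot,\cdot)_U$ for the inner product of $L^2(U)$ and of $L^2(U)^2$, and $u|_S$ for the trace of $u$ on $S$. Put \[ H^1_g(\Omega)=\{u\in H^1(\Omega): u|_{\partial\Omega}=g\},\qquad \Lambda=\{v\in L^2(\Gamma): \exists\, u\in H^1(\Omega),\ u|_\Gamma=v\},\qquad \Lambda_g=\{\lambda\in\Lambda:\lambda|_{\partial\Omega}=g\}. \] Let $\lambda\in\Lambda_g$ and, for $1\le i\le n$, let $(\mathbf u_i,p_i)\in L^2(\Omega_i)^2\times H^1(\Omega_i)$ satisfy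 \[ (\mathbf u_i,\mathbf v_i)_{\Omega_i}-(K\nabla p_i,\mathbf v_i)_{\Omega_i}=0\quad\forall\,\mathbf v_i\in L^2(\Omega_i)^2,\qquad (\mathbf u_i,\nabla w_i)_{\Omega_i}=(f,w_i)_{\Omega_i}\quad\forall\, w_i\in H^1_0(\Omega_i), \] with the boundary condition $p_i|_{\Gamma_i}=\lambda|_{\Gamma_i}$. Suppose also that the weak flux continuity condition \[ \sum_{i=1}^n(\mathbf u_i,\nabla w)_{\Omega_i}=(f,w)_\Omega\quad\forall\, w\in H^1_0(\Omega) \] holds. Then, extending $\mathbf u_i$ and $p_i$ by zero outside $\Omega_i$, the functions $\mathbf u=\sum_{i=1}^n\mathbf u_i$ and $p=\sum_{i=1}^n p_i$ satisfy $\mathbf u\in L^2(\Omega)^2$, $p\in H^1_g(\Omega)$, and \[ (\mathbf u,\mathbf v)_\Omega-(K\nabla p,\mathbf v)_\Omega=0\quad\forall\,\mathbf v\in L^2(\Omega)^2,\qquad (\mathbf u,\nabla w)_\Omega=(f,w)_\Omega\quad\forall\, w\in H^1_0(\Omega). \] -/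

import Mathlib

open MeasureTheory Filter Topology
open scoped ContDiff ENNReal NNReal

noncomputable section

namespace Mortar

/-- The Euclidean plane. -/
abbrev Plane : Type := EuclideanSpace ℝ (Fin 2)

/-! ### Domains -/

/-- A bounded Lipschitz domain: a bounded, connected (nonempty) open set which, near every boundary
point and after a rotation or reflection, is the region strictly above the graph of a Lipschitz
function. -/
structure IsLipschitzDomain (Ω : Set Plane) : Prop where
  isOpen : IsOpen Ω
  isConnected : IsConnected Ω
  isBounded : Bornology.IsBounded Ω
  isGraph : ∀ x ∈ frontier Ω, ∃ r : ℝ, 0 < r ∧ ∃ (R : Plane ≃ₗᵢ[ℝ] Plane) (γ : ℝ → ℝ) (C : ℝ≥0),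
    LipschitzWith C γ ∧ ∀ y ∈ Metric.ball x r, (y ∈ Ω ↔ γ (R y 0) < R y 1)

/-- A polygonal domain: a bounded, connected (nonempty) open set whose boundary is a finite union of
line segments. The condition `interior (closure U) = U` says that `U` is the interior of a closed
polygon, i.e. it excludes slits and punctures. -/
structure IsPolygonalDomain (U : Set Plane) : Prop where
  isOpen : IsOpen U
  isConnected : IsConnected U
  isBounded : Bornology.IsBounded U
  interior_closure : interior (closure U) = U
  frontier_eq : ∃ s : Finset (Plane × Plane), frontier U = ⋃ e ∈ s, segment ℝ e.1 e.2

/-- `Ω` is divided into the non-overlapping polygonal subdomains `Ωs 0, …, Ωs (n - 1)`. -/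
structure IsPolygonalPartition (Ω : Set Plane) {n : ℕ} (Ωs : Fin n → Set Plane) : Prop where
  polygonal : ∀ i, IsPolygonalDomain (Ωs i)
  subset : ∀ i, Ωs i ⊆ Ω
  disjoint : Pairwise fun i j => Disjoint (Ωs i) (Ωs j)
  closure_eq : closure Ω = ⋃ i, closure (Ωs i)

/-- `Γ`, the union of the boundaries `Γ_i = ∂Ω_i` of all the subdomains. -/
def skeleton {n : ℕ} (Ωs : Fin n → Set Plane) : Set Plane := ⋃ i, frontier (Ωs i)

/-! ### Lebesgue and Sobolev spaces -/

/-- `v ∈ L²(U)`, for scalar or vector fields; only the values on `U` matter. -/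
def MemL2 {F : Type} [NormedAddCommGroup F] (U : Set Plane) (v : Plane → F) : Prop :=
  MemLp v 2 (volume.restrict U)

/-- `v ∈ L²(S)` for a one-dimensional set `S`, with respect to arc length. -/
def MemL2Arc (S : Set Plane) (v : Plane → ℝ) : Prop :=
  MemLp v 2 ((Measure.hausdorffMeasure 1).restrict S)

/-- The test functions `C_c^∞(U)`. -/
def IsTestFunction (U : Set Plane) (φ : Plane → ℝ) : Prop :=
  ContDiff ℝ ∞ φ ∧ HasCompactSupport φ ∧ tsupport φ ⊆ U

/-- `G` is a square integrable weak gradient of `p` on `U`. -/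
def IsWeakGrad (U : Set Plane) (p : Plane → ℝ) (G : Plane → Plane) : Prop :=
  MemL2 U G ∧ ∀ φ : Plane → ℝ, IsTestFunction U φ →
    ∫ x in U, p x • gradient φ x = - ∫ x in U, φ x • G x

/-- `p ∈ H¹(U)`. -/
def MemH1 (U : Set Plane) (p : Plane → ℝ) : Prop :=
  MemL2 U p ∧ ∃ G, IsWeakGrad U p G

open Classical in
/-- The weak gradient of `p ∈ H¹(U)`; it is determined almost everywhere on `U`. -/
def weakGrad (U : Set Plane) (p : Plane → ℝ) : Plane → Plane :=
  if h : ∃ G, IsWeakGrad U p G then h.choose else 0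

/-- The smooth functions `φ k` converge to `p` in the norm of `H¹(U)`. -/
def TendstoH1 (U : Set Plane) (φ : ℕ → Plane → ℝ) (p : Plane → ℝ) : Prop :=
  Tendsto (fun k => eLpNorm (fun x => φ k x - p x) 2 (volume.restrict U)) atTop (𝓝 0) ∧
  Tendsto (fun k => eLpNorm (fun x => gradient (φ k) x - weakGrad U p x) 2 (volume.restrict U))
    atTop (𝓝 0)

/-- `w ∈ H¹₀(U)`, the closure of `C_c^∞(U)` in `H¹(U)`. -/
def MemH10 (U : Set Plane) (w : Plane → ℝ) : Prop :=
  MemH1 U w ∧ ∃ φ : ℕ → Plane → ℝ, (∀ k, IsTestFunction U (φ k)) ∧ TendstoH1 U φ w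

/-- `p ∈ H¹(U)` and its trace `p|_S` on the one-dimensional set `S ⊆ closure U` is `t ∈ L²(S)`.
The trace is the extension by continuity of the restriction `φ ↦ φ|_S` from functions `φ` that are
smooth up to the boundary, from the norm of `H¹(U)` to that of `L²(S)`. -/
def HasTrace (U S : Set Plane) (p t : Plane → ℝ) : Prop :=
  MemH1 U p ∧ MemL2Arc S t ∧ ∃ φ : ℕ → Plane → ℝ, (∀ k, ContDiff ℝ ∞ (φ k)) ∧ TendstoH1 U φ p ∧
    Tendsto (fun k => eLpNorm (fun x => φ k x - t x) 2 ((Measure.hausdorffMeasure 1).restrict S))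
      atTop (𝓝 0)

/-- `p ∈ H¹_g(Ω)`. -/
def MemH1g (Ω : Set Plane) (g p : Plane → ℝ) : Prop :=
  MemH1 Ω p ∧ HasTrace Ω (frontier Ω) p g

/-- `Λ`, the functions in `L²(Γ)` that are traces on `Γ` of functions in `H¹(Ω)`. -/
def MemMortar (Ω Γ : Set Plane) (v : Plane → ℝ) : Prop :=
  MemL2Arc Γ v ∧ ∃ u, MemH1 Ω u ∧ HasTrace Ω Γ u v

/-- `Λ_g`, the mortars that equal `g` on `∂Ω`. -/
def MemMortarg (Ω Γ : Set Plane) (g v : Plane → ℝ) : Prop :=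
  MemMortar Ω Γ v ∧ v =ᵐ[(Measure.hausdorffMeasure 1).restrict (frontier Ω)] g

/-! ### The mixed diffusion problem -/

/-- The inner product `(u, v)_U` of `L²(U)²`. -/
def ipVec (U : Set Plane) (u v : Plane → Plane) : ℝ := ∫ x in U, inner ℝ (u x) (v x)

/-- The inner product `(f, w)_U` of `L²(U)`. -/
def ipScal (U : Set Plane) (f w : Plane → ℝ) : ℝ := ∫ x in U, f x * w x

/-- `K ∈ L^∞(Ω)` with positive definite values (symmetry is not needed). -/
def IsDiffusionTensor (Ω : Set Plane) (K : Plane → Matrix (Fin 2) (Fin 2) ℝ) : Prop :=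
  (∀ i j, MemLp (fun x => K x i j) ∞ (volume.restrict Ω)) ∧
  ∀ᵐ x ∂(volume.restrict Ω), ∀ ξ : Plane, ξ ≠ 0 → 0 < inner ℝ ξ (Matrix.toEuclideanLin (K x) ξ)

/-- `(u, p) ∈ L²(U)² × H¹(U)` satisfies `(u, v)_U - (K∇p, v)_U = 0` for all `v ∈ L²(U)²` and
`(u, ∇w)_U = (f, w)_U` for all `w ∈ H¹₀(U)`. -/
structure SolvesMixed (U : Set Plane) (K : Plane → Matrix (Fin 2) (Fin 2) ℝ) (f : Plane → ℝ)
    (u : Plane → Plane) (p : Plane → ℝ) : Prop where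
  flux_mem : MemL2 U u
  pressure_mem : MemH1 U p
  constitutive : ∀ v : Plane → Plane, MemL2 U v →
    ipVec U u v - ipVec U (fun x => Matrix.toEuclideanLin (K x) (weakGrad U p x)) v = 0
  conservation : ∀ w : Plane → ℝ, MemH10 U w → ipVec U u (weakGrad U w) = ipScal U f w

/-- The global problem: `(u, p) ∈ L²(Ω)² × H¹_g(Ω)` solves the mixed problem on `Ω`. -/
def SolvesGlobal (Ω : Set Plane) (K : Plane → Matrix (Fin 2) (Fin 2) ℝ) (f g : Plane → ℝ)
    (u : Plane → Plane) (p : Plane → ℝ) : Prop :=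
  MemH1g Ω g p ∧ SolvesMixed Ω K f u p

/-- The sum over `i` of the extensions by zero of the `v i` from `Ωs i` to the plane. -/
def glue {F : Type} [AddCommMonoid F] {n : ℕ} (Ωs : Fin n → Set Plane) (v : Fin n → Plane → F) :
    Plane → F :=
  fun x => ∑ i, (Ωs i).indicator (v i) x

end Mortar

end

/-! The constitutive and conservation laws localize, since the subdomains exhaust `Ω` up to the null
set `Γ`. The real content is that `p` lies in `H¹(Ω)`, that its weak gradient restricts to that of
each `p i`, and that its trace is `g`.

By definition of `Λ`, the mortar `lam` is the trace on `Γ` of some `w ∈ H¹(Ω)`. On each subdomain `p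
i - w` has zero boundary trace, so its extension by zero belongs to `H¹(ℝ²)`
(`isH1Supported_indicator_sub`). If `q` is the sum of these extensions, then `p = w + q` almost
everywhere on `Ω`. This gives `p ∈ H¹(Ω)`, and the gradients of `w` cancel on each subdomain.

Extension by zero rests on `enorm_setIntegral_fderiv_le`. Slicing a polygon by lines parallel to an
axis and applying the fundamental theorem of calculus on each line bounds the integral of a partial
derivative by boundary values. Applied to a smooth approximant times a test function, this makes the
boundary term vanish in the limit. A crude inequality suffices, so normals and orientations never
enter.

For the trace on `∂Ω`, `q` vanishes outside a Lipschitz domain, hence is an `H¹` limit of test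
functions on `Ω` (`IsLipschitzDomain.isH1Limit`): localize, then mollify with a kernel centred at a
small vector pointing into `Ω`. Adding test functions to smooth approximants of `w` leaves their
boundary values unchanged, so `p` keeps the trace of `w`, which is `g` there
(`HasTrace.add_isH1Limit`). -/

noncomputable section

namespace Mortar

/-! ### The boundary inequality on polygons -/

/-- A point of a bounded open subset of the line lies in an interval of the set whose endpoints
are boundary points. -/
lemma exists_Ioo_of_mem {V : Set ℝ} (hV : IsOpen V) (hb : Bornology.IsBounded V) {x : ℝ}
    (hx : x ∈ V) : ∃ a ∈ frontier V, ∃ b ∈ frontier V, x ∈ Set.Ioo a b ∧ Set.Ioo a b ⊆ V := by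
  obtain ⟨l, hl⟩ := hb.bddBelow
  obtain ⟨r, hr⟩ := hb.bddAbove
  set A := Vᶜ ∩ Set.Iic x with hA
  set B := Vᶜ ∩ Set.Ici x with hB
  have hAc : IsClosed A := hV.isClosed_compl.inter isClosed_Iic
  have hBc : IsClosed B := hV.isClosed_compl.inter isClosed_Ici
  have hAne : A.Nonempty :=
    ⟨l - 1, fun h => by linarith [hl h], by simp only [Set.mem_Iic]; linarith [hl hx]⟩
  have hBne : B.Nonempty :=
    ⟨r + 1, fun h => by linarith [hr h], by simp only [Set.mem_Ici]; linarith [hr hx]⟩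
  have hAb : BddAbove A := ⟨x, fun y hy => hy.2⟩
  have hBb : BddBelow B := ⟨x, fun y hy => hy.2⟩
  have ha := hAc.csSup_mem hAne hAb
  have hb' := hBc.csInf_mem hBne hBb
  set a := sSup A
  set b := sInf B
  have hax : a < x := lt_of_le_of_ne ha.2 (fun h => ha.1 (h ▸ hx))
  have hxb : x < b := lt_of_le_of_ne hb'.2 (fun h => hb'.1 (h ▸ hx))
  have hsub : Set.Ioo a b ⊆ V := by
    intro y hy
    by_contra hyV
    rcases le_total y x with h | h
    · exact absurd (le_csSup hAb ⟨hyV, h⟩) (not_le.2 hy.1)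
    · exact absurd (csInf_le hBb ⟨hyV, h⟩) (not_le.2 hy.2)
  have hcl : Set.Icc a b ⊆ closure V := by
    rw [← closure_Ioo (hax.trans hxb).ne]
    exact closure_mono hsub
  refine ⟨a, ?_, b, ?_, ⟨hax, hxb⟩, hsub⟩
  · rw [hV.frontier_eq]
    exact ⟨hcl ⟨le_rfl, (hax.trans hxb).le⟩, ha.1⟩
  · rw [hV.frontier_eq]
    exact ⟨hcl ⟨(hax.trans hxb).le, le_rfl⟩, hb'.1⟩

/-- The components of `V` are intervals with endpoints in `S`, and the fundamental theorem of
calculus bounds each contribution by two endpoint values. Summing over all pairs in `S ×ˢ S` counts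
every point `2 * S.card` times. -/
lemma enorm_setIntegral_deriv_le {V : Set ℝ} (hV : IsOpen V) (hb : Bornology.IsBounded V)
    (S : Finset ℝ) (hS : frontier V ⊆ S) {f : ℝ → ℝ} (hf : ContDiff ℝ 1 f) :
    ‖∫ x in V, deriv f x‖ₑ ≤ 2 * S.card * ∑ s ∈ S, ‖f s‖ₑ := by
  classical
  -- Pairs that do not bound a component receive the empty set. Requiring both endpoints to lie
  -- outside `V` forces distinct intervals to be disjoint.
  set J : ℝ × ℝ → Set ℝ := fun ab =>
    if Set.Ioo ab.1 ab.2 ⊆ V ∧ ab.1 ∉ V ∧ ab.2 ∉ V then Set.Ioo ab.1 ab.2 else ∅ with hJ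
  have hfr : ∀ a ∈ frontier V, a ∉ V := fun a ha => by
    rw [hV.frontier_eq] at ha
    exact ha.2
  have hcov : V = ⋃ ab ∈ S ×ˢ S, J ab := by
    apply Set.Subset.antisymm
    · intro x hx
      obtain ⟨a, ha, b, hb, hxab, hsub⟩ := exists_Ioo_of_mem hV hb hx
      refine Set.mem_biUnion (x := (a, b)) ?_ ?_
      · exact Finset.mem_coe.2 (Finset.mk_mem_product (hS ha) (hS hb))
      · simp only [hJ]
        rw [if_pos ⟨hsub, hfr a ha, hfr b hb⟩]
        exact hxab
    · refine Set.iUnion₂_subset fun ab _ => ?_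
      simp only [hJ]
      split_ifs with h
      · exact h.1
      · exact Set.empty_subset _
  have hmeas : ∀ ab ∈ S ×ˢ S, MeasurableSet (J ab) := fun ab _ => by
    simp only [hJ]
    split_ifs
    · exact measurableSet_Ioo
    · exact MeasurableSet.empty
  have hdisj : Set.Pairwise (↑(S ×ˢ S)) (Function.onFun Disjoint J) := by
    rintro ⟨a, b⟩ - ⟨c, d⟩ - hne
    refine Set.disjoint_left.2 fun x hx hx' => hne ?_
    simp only [hJ] at hx hx'
    split_ifs at hx hx' with h h'
    · have h1 : a = c := by
        rcases lt_trichotomy a c with h1 | h1 | h1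
        · exact absurd (h.1 ⟨h1, hx'.1.trans hx.2⟩) h'.2.1
        · exact h1
        · exact absurd (h'.1 ⟨h1, hx.1.trans hx'.2⟩) h.2.1
      have h2 : b = d := by
        rcases lt_trichotomy b d with h1 | h1 | h1
        · exact absurd (h'.1 ⟨hx'.1.trans hx.2, h1⟩) h.2.2
        · exact h1
        · exact absurd (h.1 ⟨hx.1.trans hx'.2, h1⟩) h'.2.2
      rw [h1, h2]
    all_goals first | exact hx.elim | exact hx'.elim
  have hcont : Continuous (deriv f) := hf.continuous_deriv le_rfl
  have hint : ∀ ab ∈ S ×ˢ S, IntegrableOn (deriv f) (J ab) := fun ab _ => by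
    simp only [hJ]
    split_ifs
    · exact (hcont.continuousOn.integrableOn_Icc).mono_set Set.Ioo_subset_Icc_self
    · exact integrableOn_empty
  have hterm : ∀ ab ∈ S ×ˢ S, ‖∫ x in J ab, deriv f x‖ₑ ≤ ‖f ab.1‖ₑ + ‖f ab.2‖ₑ := by
    rintro ⟨a, b⟩ -
    simp only [hJ]
    split_ifs
    · rcases le_total a b with hab | hab
      · rw [← integral_Ioc_eq_integral_Ioo, ← intervalIntegral.integral_of_le hab,
          intervalIntegral.integral_deriv_eq_sub
            (fun x _ => (hf.differentiable one_ne_zero).differentiableAt)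
            (hcont.intervalIntegrable _ _)]
        exact (enorm_sub_le).trans (add_comm _ _).le
      · simp [Set.Ioo_eq_empty (not_lt.2 hab)]
    · simp
  conv_lhs => rw [hcov]
  rw [integral_biUnion_finset _ hmeas hdisj hint]
  calc ‖∑ ab ∈ S ×ˢ S, ∫ x in J ab, deriv f x‖ₑ
      ≤ ∑ ab ∈ S ×ˢ S, ‖∫ x in J ab, deriv f x‖ₑ := enorm_sum_le _ _
    _ ≤ ∑ ab ∈ S ×ˢ S, (‖f ab.1‖ₑ + ‖f ab.2‖ₑ) := Finset.sum_le_sum hterm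
    _ = 2 * S.card * ∑ s ∈ S, ‖f s‖ₑ := by
      rw [Finset.sum_add_distrib, Finset.sum_product, Finset.sum_product]
      simp only [Finset.sum_const, nsmul_eq_mul, ← Finset.mul_sum]
      ring

/-- The coordinates of the plane with the `j`-th coordinate put first. -/
def coordMap (j : Fin 2) (z : ℝ × ℝ) : Plane :=
  WithLp.toLp 2 (fun i => if i = j then z.1 else z.2)

lemma coordMap_apply_self (j : Fin 2) (z : ℝ × ℝ) : coordMap j z j = z.1 := by
  simp [coordMap]

lemma coordMap_apply_rev (j : Fin 2) (z : ℝ × ℝ) : coordMap j z j.rev = z.2 := by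
  fin_cases j <;> simp [coordMap]

lemma coordMap_eta (j : Fin 2) (x : Plane) : coordMap j (x j, x j.rev) = x := by
  ext i
  fin_cases j <;> fin_cases i <;> simp [coordMap]

lemma continuous_coordMap (j : Fin 2) : Continuous (coordMap j) := by
  refine (PiLp.continuous_toLp 2 _).comp (continuous_pi fun i => ?_)
  split_ifs <;> fun_prop

/-- `coordMap j` as a homeomorphism. -/
def coordHomeomorph (j : Fin 2) : ℝ × ℝ ≃ₜ Plane where
  toFun := coordMap j
  invFun x := (x j, x j.rev)
  left_inv z := by simp [coordMap_apply_self, coordMap_apply_rev]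
  right_inv x := coordMap_eta j x
  continuous_toFun := continuous_coordMap j
  continuous_invFun := by fun_prop

lemma measurePreserving_coordMap (j : Fin 2) : MeasurePreserving (coordMap j) := by
  have h0 := (PiLp.volume_preserving_toLp (Fin 2)).comp
    (volume_preserving_finTwoArrow ℝ).symm
  fin_cases j
  · convert! h0 using 1
    ext z i
    fin_cases i <;> simp [coordMap, MeasurableEquiv.finTwoArrow]
  · convert! h0.comp (Measure.measurePreserving_swap (μ := (volume : Measure ℝ))
      (ν := (volume : Measure ℝ))) using 1
    ext z i
    fin_cases i <;> simp [coordMap, MeasurableEquiv.finTwoArrow]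

lemma hasDerivAt_coordMap (j : Fin 2) (x y : ℝ) :
    HasDerivAt (fun x => coordMap j (x, y)) (EuclideanSpace.single j 1) x := by
  have h : (fun x => coordMap j (x, y)) =
      fun x => x • EuclideanSpace.single j (1 : ℝ) + coordMap j (0, y) := by
    ext x i
    by_cases h : i = j <;> simp [coordMap, h]
  rw [h]
  simpa using ((hasDerivAt_id x).smul_const (EuclideanSpace.single j (1 : ℝ))).add_const
    (coordMap j (0, y))

/-- The point of the line through `e.1` and `e.2` at height `y` in the coordinate `h`. -/
def pointAt (h : Fin 2) (e : Plane × Plane) (y : ℝ) : Plane :=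
  AffineMap.lineMap e.1 e.2 ((y - e.1 h) / (e.2 h - e.1 h))

lemma pointAt_apply {h : Fin 2} {e : Plane × Plane} (he : e.1 h ≠ e.2 h) (y : ℝ) :
    pointAt h e y h = y := by
  have : e.2 h - e.1 h ≠ 0 := sub_ne_zero.2 he.symm
  simp only [pointAt, AffineMap.lineMap_apply, vsub_eq_sub, vadd_eq_add, PiLp.add_apply,
    PiLp.smul_apply, PiLp.sub_apply, smul_eq_mul]
  field_simp
  ring

lemma continuous_pointAt (h : Fin 2) (e : Plane × Plane) : Continuous (pointAt h e) := by
  unfold pointAt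
  simp only [AffineMap.lineMap_apply, vsub_eq_sub, vadd_eq_add]
  fun_prop

lemma eq_pointAt_of_mem_segment {h : Fin 2} {e : Plane × Plane} (he : e.1 h ≠ e.2 h) {z : Plane}
    (hz : z ∈ segment ℝ e.1 e.2) : z = pointAt h e (z h) := by
  rw [segment_eq_image_lineMap] at hz
  obtain ⟨t, -, rfl⟩ := hz
  have : e.2 h - e.1 h ≠ 0 := sub_ne_zero.2 he.symm
  unfold pointAt
  congr 1
  simp only [AffineMap.lineMap_apply, vsub_eq_sub, vadd_eq_add, PiLp.add_apply,
    PiLp.smul_apply, PiLp.sub_apply, smul_eq_mul]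
  field_simp
  ring

lemma apply_mem_uIcc_of_mem_segment {h : Fin 2} {e : Plane × Plane} {z : Plane}
    (hz : z ∈ segment ℝ e.1 e.2) : z h ∈ Set.uIcc (e.1 h) (e.2 h) := by
  rw [← segment_eq_uIcc]
  have := Set.mem_image_of_mem (EuclideanSpace.proj h : Plane →L[ℝ] ℝ).toLinearMap.toAffineMap hz
  rw [image_segment] at this
  exact this

lemma pointAt_mem_segment {h : Fin 2} {e : Plane × Plane} (he : e.1 h ≠ e.2 h) {y : ℝ}
    (hy : y ∈ Set.uIcc (e.1 h) (e.2 h)) : pointAt h e y ∈ segment ℝ e.1 e.2 := by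
  rw [segment_eq_image_lineMap]
  refine Set.mem_image_of_mem _ ?_
  rw [← segment_eq_uIcc, segment_eq_image_lineMap] at hy
  obtain ⟨t, ht, rfl⟩ := hy
  have : e.2 h - e.1 h ≠ 0 := sub_ne_zero.2 he.symm
  convert! ht using 1
  simp only [AffineMap.lineMap_apply, vsub_eq_sub, vadd_eq_add, smul_eq_mul]
  field_simp
  ring

/-- Projecting a segment to a coordinate axis does not increase length. -/
lemma lintegral_pointAt_le {h : Fin 2} {e : Plane × Plane} (he : e.1 h ≠ e.2 h)
    {F : Plane → ℝ≥0∞} (hF : Measurable F) :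
    ∫⁻ y in Set.uIcc (e.1 h) (e.2 h), F (pointAt h e y) ≤
      ∫⁻ x in segment ℝ e.1 e.2, F x ∂Measure.hausdorffMeasure 1 := by
  have hm : Measurable (pointAt h e) := (continuous_pointAt h e).measurable
  rw [← lintegral_map hF hm]
  refine lintegral_mono' ?_ le_rfl
  refine Measure.le_iff.2 fun A hA => ?_
  rw [Measure.map_apply hm hA, Measure.restrict_apply (hm hA), Measure.restrict_apply hA,
    ← hausdorffMeasure_real]
  -- With Lebesgue measure written as one-dimensional Hausdorff measure, the claim reduces to the
  -- coordinate being 1-Lipschitz.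
  have hl : LipschitzWith 1 (fun x : Plane => x h) := by
    refine LipschitzWith.of_dist_le_mul fun x y => ?_
    rw [dist_eq_norm, dist_eq_norm, NNReal.coe_one, one_mul, ← PiLp.sub_apply]
    exact PiLp.norm_apply_le _ _
  calc Measure.hausdorffMeasure 1 (pointAt h e ⁻¹' A ∩ Set.uIcc (e.1 h) (e.2 h))
      ≤ Measure.hausdorffMeasure 1 ((fun x : Plane => x h) '' (A ∩ segment ℝ e.1 e.2)) := by
        refine measure_mono fun y hy => ⟨pointAt h e y, ⟨hy.1, pointAt_mem_segment he hy.2⟩, ?_⟩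
        exact pointAt_apply he y
    _ ≤ _ := by simpa using hl.hausdorffMeasure_image_le zero_le_one (A ∩ segment ℝ e.1 e.2)

/-- Several edges may cross a line at the same point; counting that point once only decreases a sum
of nonnegative terms. -/
lemma sum_image_le_sum {ι : Type*} [DecidableEq ℝ] (s : Finset ι) (r : ι → ℝ) (f : ℝ → ℝ≥0∞) :
    ∑ x ∈ s.image r, f x ≤ ∑ i ∈ s, f (r i) := by
  rw [Finset.sum_comp f r]
  refine Finset.sum_le_sum fun x hx => ?_
  have hne : (s.filter (fun i => r i = x)).card ≠ 0 := by
    obtain ⟨i, hi, rfl⟩ := Finset.mem_image.1 hx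
    exact Finset.card_ne_zero_of_mem (Finset.mem_filter.2 ⟨hi, rfl⟩)
  rw [nsmul_eq_mul]
  exact le_mul_of_one_le_left (zero_le) (by exact_mod_cast Nat.one_le_iff_ne_zero.2 hne)

/-- The integral of a partial derivative over a set bounded by finitely many segments is controlled
by the boundary values. -/
lemma enorm_setIntegral_fderiv_le {U : Set Plane} (hU : IsOpen U) (hb : Bornology.IsBounded U)
    {s : Finset (Plane × Plane)} (hs : frontier U = ⋃ e ∈ s, segment ℝ e.1 e.2)
    {F : Plane → ℝ} (hF : ContDiff ℝ 1 F) (j : Fin 2) :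
    ‖∫ x in U, fderiv ℝ F x (EuclideanSpace.single j 1)‖ₑ ≤
      2 * s.card * s.card * ∫⁻ x in frontier U, ‖F x‖ₑ ∂Measure.hausdorffMeasure 1 := by
  classical
  set D : Plane → ℝ := fun x => fderiv ℝ F x (EuclideanSpace.single j 1) with hD
  have hDc : Continuous D := (hF.continuous_fderiv one_ne_zero).clm_apply continuous_const
  have hDi : IntegrableOn D U :=
    (hDc.continuousOn.integrableOn_compact hb.isCompact_closure).mono_set subset_closure
  have hemb := (coordHomeomorph j).measurableEmbedding
  have hmp := measurePreserving_coordMap j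
  have hint : Integrable (fun z => U.indicator D (coordMap j z)) :=
    (hmp.integrable_comp_emb hemb).2 (hDi.integrable_indicator hU.measurableSet)
  rw [← integral_indicator hU.measurableSet, ← hmp.integral_comp hemb (U.indicator D),
    Measure.volume_eq_prod, integral_prod_symm _ hint]
  set N : ℝ≥0∞ := (s.card : ℝ≥0∞) with hN
  -- Edges parallel to the direction of differentiation are dropped: they lie on finitely many
  -- slicing lines, whose heights `hbad` excludes.
  set T := s.filter (fun e => e.1 j.rev ≠ e.2 j.rev) with hT
  have hslice : ∀ᵐ y : ℝ, ‖∫ x, U.indicator D (coordMap j (x, y))‖ₑ ≤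
      2 * N * ∑ e ∈ T, (Set.uIcc (e.1 j.rev) (e.2 j.rev)).indicator
        (fun y => ‖F (pointAt j.rev e y)‖ₑ) y := by
    have hbad : ∀ᵐ y : ℝ, y ∉ (s.image (fun e => e.1 j.rev) : Finset ℝ) :=
      (s.image (fun e => e.1 j.rev)).finite_toSet.measure_zero volume |> measure_eq_zero_iff_ae_notMem.1
    filter_upwards [hbad] with y hy
    have hc : Continuous fun x => coordMap j (x, y) := (continuous_coordMap j).comp (by fun_prop)
    set V := (fun x => coordMap j (x, y)) ⁻¹' U with hV
    have hVo : IsOpen V := hU.preimage hc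
    have hVb : Bornology.IsBounded V := by
      obtain ⟨R, hR⟩ := hb.exists_norm_le
      refine (Metric.isBounded_closedBall (x := (0 : ℝ)) (r := R)).subset fun x hx => ?_
      rw [mem_closedBall_zero_iff]
      refine le_trans ?_ (hR _ hx)
      have := PiLp.norm_apply_le (coordMap j (x, y)) j
      rwa [coordMap_apply_self] at this
    have hder : ∀ x, deriv (fun x => F (coordMap j (x, y))) x = D (coordMap j (x, y)) := by
      intro x
      exact ((hF.differentiable one_ne_zero _).hasFDerivAt.comp_hasDerivAt x
        (hasDerivAt_coordMap j x y)).deriv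
    have hFs : ContDiff ℝ 1 (fun x => F (coordMap j (x, y))) := by
      rw [contDiff_one_iff_deriv]
      refine ⟨fun x => ((hF.differentiable one_ne_zero _).hasFDerivAt.comp_hasDerivAt x
        (hasDerivAt_coordMap j x y)).differentiableAt, ?_⟩
      rw [show deriv (fun x => F (coordMap j (x, y))) = fun x => D (coordMap j (x, y)) from
        funext hder]
      exact hDc.comp hc
    set Ty := T.filter (fun e => y ∈ Set.uIcc (e.1 j.rev) (e.2 j.rev)) with hTy
    -- The boundary of a slice lies in the slice of the boundary, and an edge not parallel to the
    -- line meets it in one point at most.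
    have hfr : frontier V ⊆ (Ty.image (fun e => pointAt j.rev e y j) : Finset ℝ) := by
      intro x hx
      have hx' := hc.frontier_preimage_subset U hx
      rw [Set.mem_preimage, hs] at hx'
      simp only [Set.mem_iUnion] at hx'
      obtain ⟨e, he, hxe⟩ := hx'
      have hye := apply_mem_uIcc_of_mem_segment (h := j.rev) hxe
      rw [coordMap_apply_rev] at hye
      have hne : e.1 j.rev ≠ e.2 j.rev := by
        intro heq
        rw [← heq, Set.uIcc_self] at hye
        exact hy (Finset.mem_coe.2 (Finset.mem_image.2 ⟨e, he, hye.symm⟩))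
      refine Finset.mem_coe.2 (Finset.mem_image.2 ⟨e, ?_, ?_⟩)
      · rw [hTy, hT]
        exact Finset.mem_filter.2 ⟨Finset.mem_filter.2 ⟨he, hne⟩, hye⟩
      · have := eq_pointAt_of_mem_segment hne hxe
        rw [coordMap_apply_rev] at this
        change pointAt j.rev e y j = x
        rw [← this, coordMap_apply_self]
    have key := enorm_setIntegral_deriv_le hVo hVb _ hfr hFs
    have hI : ∫ x, U.indicator D (coordMap j (x, y)) =
        ∫ x in V, deriv (fun x => F (coordMap j (x, y))) x := by
      rw [← integral_indicator hVo.measurableSet]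
      congr 1
      ext x
      simp only [Set.indicator, hder]
      rfl
    rw [hI]
    refine key.trans ?_
    have hcard : ((Ty.image (fun e => pointAt j.rev e y j)).card : ℝ≥0∞) ≤ N := by
      rw [hN]
      exact_mod_cast Finset.card_image_le.trans
        ((Finset.card_filter_le _ _).trans (Finset.card_filter_le _ _))
    gcongr
    refine (sum_image_le_sum _ _ _).trans ?_
    rw [hTy, Finset.sum_filter]
    refine Finset.sum_le_sum fun e he => ?_
    have hne : e.1 j.rev ≠ e.2 j.rev := (Finset.mem_filter.1 he).2
    by_cases hye : y ∈ Set.uIcc (e.1 j.rev) (e.2 j.rev)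
    · rw [if_pos hye, Set.indicator_of_mem hye]
      have : coordMap j (pointAt j.rev e y j, y) = pointAt j.rev e y := by
        conv_rhs => rw [← coordMap_eta j (pointAt j.rev e y), pointAt_apply hne]
      rw [this]
    · rw [if_neg hye]
      exact zero_le
  have hFm : Measurable fun x => ‖F x‖ₑ := hF.continuous.measurable.enorm
  calc ‖∫ y, ∫ x, U.indicator D (coordMap j (x, y))‖ₑ
      ≤ ∫⁻ y, ‖∫ x, U.indicator D (coordMap j (x, y))‖ₑ := enorm_integral_le_lintegral_enorm _
    _ ≤ ∫⁻ y, 2 * N * ∑ e ∈ T, (Set.uIcc (e.1 j.rev) (e.2 j.rev)).indicator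
        (fun y => ‖F (pointAt j.rev e y)‖ₑ) y := lintegral_mono_ae hslice
    _ = 2 * N * ∑ e ∈ T, ∫⁻ y in Set.uIcc (e.1 j.rev) (e.2 j.rev),
          ‖F (pointAt j.rev e y)‖ₑ := by
        have hm : ∀ e ∈ T, Measurable ((Set.uIcc (e.1 j.rev) (e.2 j.rev)).indicator
            (fun y => ‖F (pointAt j.rev e y)‖ₑ)) := fun e _ =>
          (hFm.comp (continuous_pointAt _ _).measurable).indicator measurableSet_uIcc
        rw [lintegral_const_mul _ (Finset.measurable_fun_sum _ hm), lintegral_finsetSum _ hm]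
        simp_rw [lintegral_indicator measurableSet_uIcc]
    -- The segments may overlap, so each one is bounded by the whole frontier; this produces the
    -- second factor `N`.
    _ ≤ 2 * N * ∑ e ∈ T, ∫⁻ x in frontier U, ‖F x‖ₑ ∂Measure.hausdorffMeasure 1 := by
        gcongr with e he
        have he' := Finset.mem_filter.1 he
        refine (lintegral_pointAt_le he'.2 hFm).trans (lintegral_mono_set ?_)
        rw [hs]
        exact Set.subset_biUnion_of_mem (u := fun e : Plane × Plane => segment ℝ e.1 e.2) he'.1
    _ ≤ 2 * N * N * ∫⁻ x in frontier U, ‖F x‖ₑ ∂Measure.hausdorffMeasure 1 := by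
        rw [Finset.sum_const, nsmul_eq_mul, ← mul_assoc]
        gcongr
        rw [hN]
        exact_mod_cast Finset.card_filter_le _ _

/-! ### Extension by zero of functions with vanishing trace -/

lemma gradient_apply (F : Plane → ℝ) (x : Plane) (j : Fin 2) :
    gradient F x j = fderiv ℝ F x (EuclideanSpace.single j 1) := by
  rw [← inner_gradient_left, EuclideanSpace.inner_single_right]
  simp

lemma continuous_gradient {F : Plane → ℝ} (hF : ContDiff ℝ 1 F) : Continuous (gradient F) :=
  (InnerProductSpace.toDual ℝ Plane).symm.continuous.comp (hF.continuous_fderiv one_ne_zero)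

lemma gradient_mul {a b : Plane → ℝ} (ha : Differentiable ℝ a) (hb : Differentiable ℝ b)
    (x : Plane) : gradient (fun y => a y * b y) x = a x • gradient b x + b x • gradient a x := by
  simp only [gradient]
  rw [fderiv_fun_mul (ha x) (hb x)]
  simp

lemma gradient_add {a b : Plane → ℝ} (ha : Differentiable ℝ a) (hb : Differentiable ℝ b)
    (x : Plane) : gradient (fun y => a y + b y) x = gradient a x + gradient b x := by
  simp only [gradient]
  rw [fderiv_fun_add (ha x) (hb x)]
  simp

lemma gradient_sub {a b : Plane → ℝ} (ha : Differentiable ℝ a) (hb : Differentiable ℝ b)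
    (x : Plane) : gradient (fun y => a y - b y) x = gradient a x - gradient b x := by
  simp only [gradient]
  rw [fderiv_fun_sub (ha x) (hb x)]
  simp

lemma hasCompactSupport_gradient {F : Plane → ℝ} (hF : HasCompactSupport F) :
    HasCompactSupport (gradient F) :=
  (hF.fderiv ℝ).comp_left (g := (InnerProductSpace.toDual ℝ Plane).symm) (map_zero _)

lemma integrable_smul_of_memLp_two {α E : Type*} [MeasurableSpace α] {μ : Measure α}
    [NormedAddCommGroup E] [NormedSpace ℝ E] {a : α → ℝ} {v : α → E}
    (ha : MemLp a 2 μ) (hv : MemLp v 2 μ) : Integrable (fun x => a x • v x) μ :=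
  memLp_one_iff_integrable.1 (hv.smul ha)

lemma tendsto_integral_smul_const {α E : Type*} [MeasurableSpace α] {μ : Measure α}
    [NormedAddCommGroup E] [NormedSpace ℝ E] {a : ℕ → α → ℝ} {b : α → ℝ} {v : α → E}
    (ha : ∀ k, MemLp (a k) 2 μ) (hb : MemLp b 2 μ) (hv : MemLp v 2 μ)
    (h : Tendsto (fun k => eLpNorm (fun x => a k x - b x) 2 μ) atTop (𝓝 0)) :
    Tendsto (fun k => ∫ x, a k x • v x ∂μ) atTop (𝓝 (∫ x, b x • v x ∂μ)) := by
  refine tendsto_integral_of_L1' _ (integrable_smul_of_memLp_two hb hv).aestronglyMeasurable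
    (Eventually.of_forall fun k => integrable_smul_of_memLp_two (ha k) hv) ?_
  have h0 : Tendsto (fun k => eLpNorm (fun x => a k x - b x) 2 μ * eLpNorm v 2 μ) atTop
      (𝓝 0) := by
    simpa using ENNReal.Tendsto.mul_const h (Or.inr hv.eLpNorm_ne_top)
  refine tendsto_of_tendsto_of_tendsto_of_le_of_le tendsto_const_nhds h0 (fun _ => zero_le)
    fun k => ?_
  have := eLpNorm_smul_le_mul_eLpNorm (p := 2) (q := 2) (r := 1) hv.aestronglyMeasurable
    ((ha k).sub hb).aestronglyMeasurable
  refine le_trans (le_of_eq ?_) this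
  congr 1
  ext x
  simp [sub_smul]

lemma tendsto_integral_const_smul {α E : Type*} [MeasurableSpace α] {μ : Measure α}
    [NormedAddCommGroup E] [NormedSpace ℝ E] {a : α → ℝ} {v : ℕ → α → E} {w : α → E}
    (ha : MemLp a 2 μ) (hv : ∀ k, MemLp (v k) 2 μ) (hw : MemLp w 2 μ)
    (h : Tendsto (fun k => eLpNorm (fun x => v k x - w x) 2 μ) atTop (𝓝 0)) :
    Tendsto (fun k => ∫ x, a x • v k x ∂μ) atTop (𝓝 (∫ x, a x • w x ∂μ)) := by
  refine tendsto_integral_of_L1' _ (integrable_smul_of_memLp_two ha hw).aestronglyMeasurable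
    (Eventually.of_forall fun k => integrable_smul_of_memLp_two ha (hv k)) ?_
  have h0 : Tendsto (fun k => eLpNorm a 2 μ * eLpNorm (fun x => v k x - w x) 2 μ) atTop
      (𝓝 0) := by
    simpa using ENNReal.Tendsto.const_mul h (Or.inr ha.eLpNorm_ne_top)
  refine tendsto_of_tendsto_of_tendsto_of_le_of_le tendsto_const_nhds h0 (fun _ => zero_le)
    fun k => ?_
  have := eLpNorm_smul_le_mul_eLpNorm (p := 2) (q := 2) (r := 1)
    ((hv k).sub hw).aestronglyMeasurable ha.aestronglyMeasurable
  refine le_trans (le_of_eq ?_) this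
  congr 1
  ext x
  simp [smul_sub]

/-- Continuous functions are square integrable on bounded sets. -/
lemma memL2_of_continuous {F : Type} [NormedAddCommGroup F] [SecondCountableTopology F]
    {U : Set Plane} (hb : Bornology.IsBounded U)
    {v : Plane → F} (hv : Continuous v) : MemL2 U v := by
  have : IsFiniteMeasure (volume.restrict (closure U)) :=
    isFiniteMeasure_restrict.2 hb.isCompact_closure.measure_lt_top.ne
  obtain ⟨C, hC⟩ := hb.isCompact_closure.exists_bound_of_continuousOn hv.continuousOn
  have h : MemLp v 2 (volume.restrict (closure U)) := by
    refine MemLp.of_bound hv.aestronglyMeasurable C ?_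
    exact (ae_restrict_iff' isClosed_closure.measurableSet).2 (Eventually.of_forall hC)
  exact h.mono_measure (Measure.restrict_mono subset_closure le_rfl)

/-- Finite boundary length makes bounded test functions square integrable on the boundary. -/
lemma hausdorffMeasure_frontier_lt_top {U : Set Plane} (hU : IsPolygonalDomain U) :
    Measure.hausdorffMeasure 1 (frontier U) < (⊤ : ℝ≥0∞) := by
  obtain ⟨s, hs⟩ := hU.frontier_eq
  rw [hs]
  refine (measure_biUnion_lt_top s.finite_toSet fun e _ => ?_)
  rw [hausdorffMeasure_segment]
  exact edist_lt_top _ _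

/-- If smooth functions converge to `q` in `H¹` of a polygonal domain while their boundary values
tend to zero in `L²`, then the extension of `q` by zero is weakly differentiable on the plane. -/
lemma isWeakGrad_univ_indicator {U : Set Plane} (hU : IsPolygonalDomain U) {q : Plane → ℝ}
    {G : Plane → Plane} (hq : MemL2 U q) (hG : MemL2 U G) {h : ℕ → Plane → ℝ}
    (hh : ∀ k, ContDiff ℝ ∞ (h k))
    (hval : Tendsto (fun k => eLpNorm (fun x => h k x - q x) 2 (volume.restrict U)) atTop (𝓝 0))
    (hgrad : Tendsto (fun k => eLpNorm (fun x => gradient (h k) x - G x) 2 (volume.restrict U))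
      atTop (𝓝 0))
    (htr : Tendsto (fun k => eLpNorm (h k) 2
      ((Measure.hausdorffMeasure 1).restrict (frontier U))) atTop (𝓝 0)) :
    IsWeakGrad Set.univ (U.indicator q) (U.indicator G) := by
  have hUm := hU.isOpen.measurableSet
  refine ⟨?_, fun χ hχ => ?_⟩
  · unfold MemL2
    rw [Measure.restrict_univ]
    exact (memLp_indicator_iff_restrict hUm).2 hG
  obtain ⟨hχs, hχc, -⟩ := hχ
  obtain ⟨s, hs⟩ := hU.frontier_eq
  have hb := hU.isBounded
  have hh1 : ∀ k, ContDiff ℝ 1 (h k) := fun k => (hh k).of_le (by simp)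
  have hχ1 : ContDiff ℝ 1 χ := hχs.of_le (by simp)
  have hχL : MemL2 U χ := memL2_of_continuous hb hχ1.continuous
  have hgχL : MemL2 U (gradient χ) := memL2_of_continuous hb (continuous_gradient hχ1)
  have hhL : ∀ k, MemL2 U (h k) := fun k => memL2_of_continuous hb (hh1 k).continuous
  have hghL : ∀ k, MemL2 U (gradient (h k)) := fun k =>
    memL2_of_continuous hb (continuous_gradient (hh1 k))
  have hlim := (tendsto_integral_smul_const hhL hq hgχL hval).add
    (tendsto_integral_const_smul hχL hghL hG hgrad)
  have hsum : ∀ k, (∫ x in U, h k x • gradient χ x) + ∫ x in U, χ x • gradient (h k) x =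
      ∫ x in U, gradient (fun y => h k y * χ y) x := by
    intro k
    rw [← integral_add (integrable_smul_of_memLp_two (hhL k) hgχL)
      (integrable_smul_of_memLp_two hχL (hghL k))]
    refine integral_congr_ae (Eventually.of_forall fun x => ?_)
    exact (gradient_mul ((hh1 k).differentiable one_ne_zero) (hχ1.differentiable one_ne_zero)
      x).symm
  -- This is the limit of the integrals of `gradient (h k * χ)`. The boundary inequality and Hölder
  -- bound each component by a constant times the boundary `L²` norms of `h k` and `χ`, and the
  -- former tends to zero.
  have hzero : (∫ x in U, q x • gradient χ x) + ∫ x in U, χ x • G x = 0 := by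
    ext j
    have hj := ((EuclideanSpace.proj j : Plane →L[ℝ] ℝ).continuous.tendsto _).comp hlim
    refine tendsto_nhds_unique hj ?_
    rw [PiLp.zero_apply, tendsto_zero_iff_enorm_tendsto_zero]
    set μ := (Measure.hausdorffMeasure 1 : Measure Plane).restrict (frontier U) with hμ
    have : IsFiniteMeasure μ :=
      isFiniteMeasure_restrict.2 (hausdorffMeasure_frontier_lt_top hU).ne
    have hχb : MemLp χ 2 μ := by
      obtain ⟨C, hC⟩ := hχc.exists_bound_of_continuous hχ1.continuous
      exact MemLp.of_bound hχ1.continuous.aestronglyMeasurable C (Eventually.of_forall hC)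
    set C : ℝ≥0∞ := 2 * s.card * s.card with hC
    have h0 : Tendsto (fun k => C * (eLpNorm (h k) 2 μ * eLpNorm χ 2 μ)) atTop (𝓝 0) := by
      have := ENNReal.Tendsto.const_mul (a := C)
        (ENNReal.Tendsto.mul_const htr (Or.inr hχb.eLpNorm_ne_top))
        (Or.inr (by rw [hC]; finiteness))
      simpa using this
    refine tendsto_of_tendsto_of_tendsto_of_le_of_le tendsto_const_nhds h0 (fun _ => zero_le)
      fun k => ?_
    have hprod : ContDiff ℝ 1 (fun y => h k y * χ y) := (hh1 k).mul hχ1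
    have hint : Integrable (gradient (fun y => h k y * χ y)) (volume.restrict U) := by
      have : IsFiniteMeasure (volume.restrict U) :=
        isFiniteMeasure_restrict.2 hb.measure_lt_top.ne
      exact (memL2_of_continuous hb (continuous_gradient hprod)).integrable one_le_two
    simp only [Function.comp_apply]
    rw [hsum, ← ContinuousLinearMap.integral_comp_comm _ hint]
    simp only [PiLp.proj_apply, gradient_apply]
    refine (enorm_setIntegral_fderiv_le hU.isOpen hb hs hprod j).trans ?_
    gcongr
    rw [← hμ, ← eLpNorm_one_eq_lintegral_enorm]
    exact eLpNorm_smul_le_mul_eLpNorm (p := 2) (q := 2) (r := 1) (f := χ) (φ := h k)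
      hχ1.continuous.aestronglyMeasurable (hh1 k).continuous.aestronglyMeasurable
  rw [Measure.restrict_univ]
  have e1 : (fun x => U.indicator q x • gradient χ x) =
      U.indicator (fun x => q x • gradient χ x) := by
    ext1 x
    by_cases hx : x ∈ U <;> simp [hx]
  have e2 : (fun x => χ x • U.indicator G x) = U.indicator (fun x => χ x • G x) := by
    ext1 x
    by_cases hx : x ∈ U <;> simp [hx]
  rw [e1, e2, integral_indicator hUm, integral_indicator hUm]
  exact eq_neg_of_add_eq_zero_left hzero

/-! ### Mollification -/

/-- Translation is continuous in `L²`. -/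
lemma exists_eLpNorm_translate_sub_le {F : Type*} [NormedAddCommGroup F] {f : Plane → F} (hf : MemLp f 2 volume) {ε : ℝ≥0∞}
    (hε : ε ≠ 0) : ∃ δ > 0, ∀ s : Plane, ‖s‖ < δ →
      eLpNorm (fun x => f (x - s) - f x) 2 volume ≤ ε := by
  -- Currying presents the translations as a continuous family of maps, so continuity of composition
  -- with measure-preserving maps on `Lp` applies.
  set g : C(Plane, C(Plane, Plane)) :=
    (ContinuousMap.mk (fun a : Plane × Plane => a.2 - a.1) (by fun_prop)).curry with hg
  have hgm : ∀ s, MeasurePreserving (g s) (volume : Measure Plane) volume := fun s =>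
    measurePreserving_sub_right volume s
  have : Fact ((1 : ℝ≥0∞) ≤ 2) := ⟨one_le_two⟩
  have hc : Continuous fun s => Lp.compMeasurePreserving (g s) (hgm s) (hf.toLp f) :=
    continuous_const.compMeasurePreservingLp g.continuous hgm (by simp)
  have h0 := (EMetric.tendsto_nhds.1 (hc.tendsto 0)) ε (pos_iff_ne_zero.2 hε)
  obtain ⟨δ, hδ, H⟩ := Metric.eventually_nhds_iff.1 h0
  refine ⟨δ, hδ, fun s hs => ?_⟩
  have := (H (y := s) (by simpa using hs)).le
  rw [Lp.toLp_compMeasurePreserving, Lp.toLp_compMeasurePreserving, Lp.edist_toLp_toLp] at this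
  refine le_trans (le_of_eq ?_) this
  congr 1
  ext x
  simp [hg]

lemma eLpNorm_two_sq {α E : Type*} [MeasurableSpace α] {μ : Measure α} [NormedAddCommGroup E]
    (f : α → E) : eLpNorm f 2 μ ^ 2 = ∫⁻ x, ‖f x‖ₑ ^ 2 ∂μ := by
  have := eLpNorm_nnreal_pow_eq_lintegral (f := f) (μ := μ) (p := 2) two_ne_zero
  simpa using this

/-- Averaging against a probability density moves a function in `L²` by at most the distance to its
translates by the elements of the support. -/
lemma eLpNorm_average_sub_le {F : Type*} [NormedAddCommGroup F] [NormedSpace ℝ F]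
    [CompleteSpace F] {f : Plane → F} (hf : MemLp f 2 volume) {ρ : Plane → ℝ}
    (hρc : Continuous ρ) (hρs : HasCompactSupport ρ) (hρ0 : ∀ x, 0 ≤ ρ x) (hρ1 : ∫ x, ρ x = 1)
    {ε : ℝ≥0∞}
    (hε : ∀ s, ρ s ≠ 0 → eLpNorm (fun x => f (x - s) - f x) 2 volume ≤ ε) :
    eLpNorm (fun x => (∫ t, ρ (x - t) • f t) - f x) 2 volume ≤ ε := by
  have hρi : Integrable ρ := hρc.integrable_of_hasCompactSupport hρs
  have hρL : MemLp ρ 2 volume := hρc.memLp_of_hasCompactSupport hρs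
  set r : Plane → ℝ≥0∞ := fun s => ENNReal.ofReal (ρ s) with hr
  have hrm : Measurable r := hρc.measurable.ennreal_ofReal
  have hr1 : ∫⁻ s, r s = 1 := by
    rw [hr, ← ofReal_integral_eq_lintegral_ofReal hρi (Eventually.of_forall hρ0), hρ1,
      ENNReal.ofReal_one]
  -- Under the probability measure with density `ρ`, Jensen's inequality becomes the monotonicity of
  -- `eLpNorm` in the exponent.
  have hprob : IsProbabilityMeasure (volume.withDensity r) := ⟨by
    rw [withDensity_apply _ MeasurableSet.univ, Measure.restrict_univ, hr1]⟩
  have hshift : ∀ x, MemLp (fun s => f (x - s)) 2 volume := fun x =>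
    hf.comp_measurePreserving (Measure.measurePreserving_sub_left volume x)
  have hpt : ∀ x, ‖(∫ t, ρ (x - t) • f t) - f x‖ₑ ^ 2 ≤
      ∫⁻ s, r s * ‖f (x - s) - f x‖ₑ ^ 2 := by
    intro x
    have e1 : (∫ t, ρ (x - t) • f t) - f x = ∫ s, ρ s • (f (x - s) - f x) := by
      have : (∫ t, ρ (x - t) • f t) = ∫ s, ρ s • f (x - s) := by
        rw [← integral_sub_left_eq_self (fun s => ρ s • f (x - s)) volume x]
        simp
      rw [this]
      simp_rw [smul_sub]
      rw [integral_sub (integrable_smul_of_memLp_two hρL (hshift x)) (hρi.smul_const _),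
        integral_smul_const, hρ1, one_smul]
    have hm : AEStronglyMeasurable (fun s => f (x - s) - f x) (volume.withDensity r) :=
      ((hshift x).aestronglyMeasurable.sub aestronglyMeasurable_const).mono_ac
        (withDensity_absolutelyContinuous _ _)
    have e2 : ‖(∫ t, ρ (x - t) • f t) - f x‖ₑ ≤
        eLpNorm (fun s => f (x - s) - f x) 1 (volume.withDensity r) := by
      rw [e1, eLpNorm_one_eq_lintegral_enorm,
        lintegral_withDensity_eq_lintegral_mul_non_measurable _ hrm
          (Eventually.of_forall fun _ => ENNReal.ofReal_lt_top)]
      refine (enorm_integral_le_lintegral_enorm _).trans (le_of_eq ?_)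
      congr 1
      ext s
      rw [enorm_smul, Pi.mul_apply, hr, Real.enorm_eq_ofReal (hρ0 s)]
    calc ‖(∫ t, ρ (x - t) • f t) - f x‖ₑ ^ 2
        ≤ eLpNorm (fun s => f (x - s) - f x) 2 (volume.withDensity r) ^ 2 := by
          gcongr
          exact e2.trans (eLpNorm_le_eLpNorm_of_exponent_le one_le_two hm)
      _ = ∫⁻ s, r s * ‖f (x - s) - f x‖ₑ ^ 2 := by
          rw [eLpNorm_two_sq, lintegral_withDensity_eq_lintegral_mul_non_measurable _ hrm
          (Eventually.of_forall fun _ => ENNReal.ofReal_lt_top)]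
          rfl
  have hjoint : AEMeasurable (Function.uncurry fun x s : Plane => r s * ‖f (x - s) - f x‖ₑ ^ 2)
      (volume.prod volume) := by
    have h1 : AEStronglyMeasurable (fun z : Plane × Plane => f (z.1 - z.2))
        (volume.prod volume) :=
      hf.aestronglyMeasurable.comp_quasiMeasurePreserving
        (quasiMeasurePreserving_sub_of_right_invariant volume volume)
    have h2 : AEStronglyMeasurable (fun z : Plane × Plane => f z.1) (volume.prod volume) :=
      hf.aestronglyMeasurable.comp_fst
    exact (hrm.comp measurable_snd).aemeasurable.mul ((h1.sub h2).enorm.pow_const 2)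
  have hsq : eLpNorm (fun x => (∫ t, ρ (x - t) • f t) - f x) 2 volume ^ 2 ≤ ε ^ 2 := by
    rw [eLpNorm_two_sq]
    calc ∫⁻ x, ‖(∫ t, ρ (x - t) • f t) - f x‖ₑ ^ 2
        ≤ ∫⁻ x, ∫⁻ s, r s * ‖f (x - s) - f x‖ₑ ^ 2 := lintegral_mono hpt
      _ = ∫⁻ s, ∫⁻ x, r s * ‖f (x - s) - f x‖ₑ ^ 2 := lintegral_lintegral_swap hjoint
      _ = ∫⁻ s, r s * eLpNorm (fun x => f (x - s) - f x) 2 volume ^ 2 := by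
          congr 1
          ext s
          rw [lintegral_const_mul' _ _ ENNReal.ofReal_ne_top, eLpNorm_two_sq]
      _ ≤ ∫⁻ s, r s * ε ^ 2 := by
          refine lintegral_mono fun s => ?_
          by_cases hs : ρ s = 0
          · simp [hr, hs]
          · gcongr
            exact hε s hs
      _ = ε ^ 2 := by rw [lintegral_mul_const _ hrm, hr1, one_mul]
  exact (ENNReal.pow_le_pow_left_iff two_ne_zero).1 hsq

/-- The mollification of `q` by `ρ`. -/
def mollify (ρ : Plane → ℝ) (q : Plane → ℝ) (x : Plane) : ℝ := ∫ t, ρ (x - t) • q t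

lemma mollify_eq_convolution (ρ q : Plane → ℝ) :
    mollify ρ q = convolution q ρ (ContinuousLinearMap.lsmul ℝ ℝ) volume := by
  ext x
  simp [mollify, convolution_def, mul_comm]

lemma contDiff_mollify {ρ q : Plane → ℝ} (hρ : ContDiff ℝ ∞ ρ) (hρs : HasCompactSupport ρ)
    (hq : MemLp q 2 volume) : ContDiff ℝ ∞ (mollify ρ q) := by
  rw [mollify_eq_convolution]
  exact hρs.contDiff_convolution_right _ (hq.locallyIntegrable one_le_two) hρ

lemma gradient_comp_sub_left {ρ : Plane → ℝ} (hρ : Differentiable ℝ ρ) (x t : Plane) :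
    gradient (fun t => ρ (x - t)) t = - gradient ρ (x - t) := by
  ext j
  rw [PiLp.neg_apply, gradient_apply, gradient_apply]
  have h : HasFDerivAt (fun t => ρ (x - t))
      ((fderiv ℝ ρ (x - t)).comp (-ContinuousLinearMap.id ℝ Plane)) t :=
    (hρ (x - t)).hasFDerivAt.comp t ((hasFDerivAt_id t).const_sub x)
  rw [h.fderiv]
  simp

/-- The gradient of a mollification is the mollification of the weak gradient. -/
lemma gradient_mollify {ρ q : Plane → ℝ} {G : Plane → Plane} (hρ : ContDiff ℝ ∞ ρ)
    (hρs : HasCompactSupport ρ) (hq : MemLp q 2 volume) (hG : IsWeakGrad Set.univ q G)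
    (x : Plane) : gradient (mollify ρ q) x = ∫ t, ρ (x - t) • G t := by
  have hρ1 : ContDiff ℝ 1 ρ := hρ.of_le (by simp)
  have hl := hq.locallyIntegrable (μ := (volume : Measure Plane)) one_le_two
  -- Reflecting `ρ` changes the sign of its gradient, which cancels the sign in the definition of
  -- the weak gradient tested with `χ`.
  set χ : Plane → ℝ := fun t => ρ (x - t) with hχ
  have hχs : ContDiff ℝ ∞ χ := hρ.comp (contDiff_const.sub contDiff_id)
  have hχ1 : ContDiff ℝ 1 χ := hχs.of_le (by simp)
  have hχc : HasCompactSupport χ := hρs.comp_homeomorph (Homeomorph.subLeft x)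
  have hw := hG.2 χ ⟨hχs, hχc, Set.subset_univ _⟩
  simp only [Measure.restrict_univ] at hw
  have hint : Integrable (fun t => q t • gradient χ t) :=
    integrable_smul_of_memLp_two hq
      ((continuous_gradient hχ1).memLp_of_hasCompactSupport (hasCompactSupport_gradient hχc))
  have hgoal : gradient (mollify ρ q) x = - ∫ t, q t • gradient χ t := by
    ext j
    have hj : (∫ t, q t • gradient χ t) j = ∫ t, (q t • gradient χ t) j :=
      ((EuclideanSpace.proj j : Plane →L[ℝ] ℝ).integral_comp_comm hint).symm
    rw [PiLp.neg_apply, hj, gradient_apply, mollify_eq_convolution,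
      (hρs.hasFDerivAt_convolution_right (ContinuousLinearMap.lsmul ℝ ℝ) hl hρ1 x).fderiv,
      convolution_precompR_apply _ hl (hρs.fderiv ℝ) (hρ1.continuous_fderiv one_ne_zero),
      convolution_def, ← integral_neg]
    congr 1
    ext t
    rw [hχ, gradient_comp_sub_left (hρ1.differentiable one_ne_zero)]
    simp [gradient_apply]
  rw [hgoal, hw, neg_neg]

/-! ### Functions on the plane that vanish outside a set -/

/-- `q ∈ H¹(ℝ²)` with weak gradient `G`, both vanishing outside `A`. -/
structure IsH1Supported (A : Set Plane) (q : Plane → ℝ) (G : Plane → Plane) : Prop where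
  memLp : MemLp q 2 volume
  memLp_grad : MemLp G 2 volume
  weak : IsWeakGrad Set.univ q G
  eq_zero : ∀ x ∉ A, q x = 0
  grad_eq_zero : ∀ x ∉ A, G x = 0

/-- `q`, with gradient `G`, is a limit of test functions on `Ω` in `H¹(ℝ²)`. -/
def IsH1Limit (Ω : Set Plane) (q : Plane → ℝ) (G : Plane → Plane) : Prop :=
  ∀ ε : ℝ≥0∞, ε ≠ 0 → ∃ φ, IsTestFunction Ω φ ∧ eLpNorm (fun x => φ x - q x) 2 volume ≤ ε ∧
    eLpNorm (fun x => gradient φ x - G x) 2 volume ≤ ε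

lemma IsH1Supported.mono {A B : Set Plane} {q : Plane → ℝ} {G : Plane → Plane}
    (h : IsH1Supported A q G) (hAB : A ⊆ B) : IsH1Supported B q G :=
  ⟨h.memLp, h.memLp_grad, h.weak, fun x hx => h.eq_zero x fun h' => hx (hAB h'),
    fun x hx => h.grad_eq_zero x fun h' => hx (hAB h')⟩

/-- The product rule follows by testing the weak gradient of `q` with `θ * χ`. Boundedness of `A`
replaces compact support of `θ`, so that `1 - θ` is also allowed for a bump `θ`. -/
lemma IsH1Supported.mul {A : Set Plane} {q : Plane → ℝ} {G : Plane → Plane}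
    (h : IsH1Supported A q G) (hA : Bornology.IsBounded A) {θ : Plane → ℝ}
    (hθ : ContDiff ℝ ∞ θ) :
    IsH1Supported A (fun x => θ x * q x) (fun x => θ x • G x + q x • gradient θ x) := by
  have hθ1 : ContDiff ℝ 1 θ := hθ.of_le (by simp)
  have hgθ := continuous_gradient hθ1
  obtain ⟨C, hC⟩ := hA.isCompact_closure.exists_bound_of_continuousOn hθ1.continuous.continuousOn
  obtain ⟨D, hD⟩ := hA.isCompact_closure.exists_bound_of_continuousOn hgθ.continuousOn
  have m1 : MemLp (fun x => θ x * q x) 2 volume := by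
    refine h.memLp.of_le_mul (c := C)
      (hθ1.continuous.aestronglyMeasurable.mul h.memLp.aestronglyMeasurable)
      (Eventually.of_forall fun x => ?_)
    by_cases hx : x ∈ A
    · rw [norm_mul]
      gcongr
      exact hC x (subset_closure hx)
    · simp [h.eq_zero x hx]
  have m2 : MemLp (fun x => θ x • G x) 2 volume := by
    refine h.memLp_grad.of_le_mul (c := C)
      (hθ1.continuous.aestronglyMeasurable.smul h.memLp_grad.aestronglyMeasurable)
      (Eventually.of_forall fun x => ?_)
    by_cases hx : x ∈ A
    · rw [norm_smul]
      gcongr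
      exact hC x (subset_closure hx)
    · simp [h.grad_eq_zero x hx]
  have m3 : MemLp (fun x => q x • gradient θ x) 2 volume := by
    refine h.memLp.of_le_mul (c := D)
      (h.memLp.aestronglyMeasurable.smul hgθ.aestronglyMeasurable)
      (Eventually.of_forall fun x => ?_)
    by_cases hx : x ∈ A
    · rw [norm_smul, mul_comm]
      gcongr
      exact hD x (subset_closure hx)
    · simp [h.eq_zero x hx]
  refine ⟨m1, m2.add m3, ⟨?_, fun χ hχ => ?_⟩, fun x hx => ?_, fun x hx => ?_⟩
  · unfold MemL2
    rw [Measure.restrict_univ]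
    exact m2.add m3
  · obtain ⟨hχs, hχc, -⟩ := hχ
    have hχ1 : ContDiff ℝ 1 χ := hχs.of_le (by simp)
    have hχL : MemLp χ 2 volume := hχ1.continuous.memLp_of_hasCompactSupport hχc
    have hw := h.weak.2 (fun x => θ x * χ x) ⟨hθ.mul hχs, hχc.mul_left, Set.subset_univ _⟩
    simp only [Measure.restrict_univ] at hw ⊢
    have hgχL : MemLp (gradient χ) 2 volume :=
      (continuous_gradient hχ1).memLp_of_hasCompactSupport (hasCompactSupport_gradient hχc)
    have i1 : Integrable (fun x => (θ x * q x) • gradient χ x) :=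
      integrable_smul_of_memLp_two m1 hgχL
    have i2 : Integrable (fun x => χ x • (q x • gradient θ x)) :=
      integrable_smul_of_memLp_two hχL m3
    have i3 : Integrable (fun x => χ x • (θ x • G x)) := integrable_smul_of_memLp_two hχL m2
    have e1 : (∫ x, q x • gradient (fun x => θ x * χ x) x) =
        (∫ x, (θ x * q x) • gradient χ x) + ∫ x, χ x • (q x • gradient θ x) := by
      rw [← integral_add i1 i2]
      congr 1
      ext1 x
      rw [gradient_mul (hθ1.differentiable one_ne_zero) (hχ1.differentiable one_ne_zero),
        smul_add, smul_smul, smul_comm (q x) (χ x), mul_comm]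
    have e2 : (∫ x, (θ x * χ x) • G x) = ∫ x, χ x • (θ x • G x) := by
      congr 1
      ext1 x
      rw [smul_smul, mul_comm]
    rw [e1, e2] at hw
    simp_rw [smul_add]
    rw [integral_add i3 i2, neg_add, ← hw]
    abel
  · simp [h.eq_zero x hx]
  · simp [h.eq_zero x hx, h.grad_eq_zero x hx]

lemma gradient_eq_zero_of_notMem_tsupport {θ : Plane → ℝ} {x : Plane} (hx : x ∉ tsupport θ) :
    gradient θ x = 0 := by
  have : fderiv ℝ θ x = 0 := by
    by_contra h
    exact hx (support_fderiv_subset ℝ h)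
  simp [gradient, this]

lemma IsH1Limit.add {Ω : Set Plane} {q₁ q₂ : Plane → ℝ} {G₁ G₂ : Plane → Plane}
    (h₁ : IsH1Limit Ω q₁ G₁) (h₂ : IsH1Limit Ω q₂ G₂) (m₁ : MemLp q₁ 2 volume)
    (m₂ : MemLp q₂ 2 volume) (n₁ : MemLp G₁ 2 volume) (n₂ : MemLp G₂ 2 volume) :
    IsH1Limit Ω (fun x => q₁ x + q₂ x) (fun x => G₁ x + G₂ x) := by
  intro ε hε
  have hε2 : ε / 2 ≠ 0 := (ENNReal.half_pos hε).ne'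
  obtain ⟨φ, ⟨hφs, hφc, hφt⟩, hφ1, hφ2⟩ := h₁ _ hε2
  obtain ⟨ψ, ⟨hψs, hψc, hψt⟩, hψ1, hψ2⟩ := h₂ _ hε2
  have hφ1' : ContDiff ℝ 1 φ := hφs.of_le (by simp)
  have hψ1' : ContDiff ℝ 1 ψ := hψs.of_le (by simp)
  refine ⟨fun x => φ x + ψ x, ⟨hφs.add hψs, hφc.add hψc, ?_⟩, ?_, ?_⟩
  · exact (tsupport_add φ ψ).trans (Set.union_subset hφt hψt)
  · have := eLpNorm_add_le (hφ1'.continuous.aestronglyMeasurable.sub m₁.aestronglyMeasurable)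
      (hψ1'.continuous.aestronglyMeasurable.sub m₂.aestronglyMeasurable) one_le_two
      (μ := (volume : Measure Plane))
    refine le_trans (le_of_eq ?_) (this.trans ((add_le_add hφ1 hψ1).trans (ENNReal.add_halves ε).le))
    congr 1
    ext x
    simp only [Pi.add_apply, Pi.sub_apply]
    ring
  · have := eLpNorm_add_le
      ((continuous_gradient hφ1').aestronglyMeasurable.sub n₁.aestronglyMeasurable)
      ((continuous_gradient hψ1').aestronglyMeasurable.sub n₂.aestronglyMeasurable) one_le_two
      (μ := (volume : Measure Plane))
    refine le_trans (le_of_eq ?_) (this.trans ((add_le_add hφ2 hψ2).trans (ENNReal.add_halves ε).le))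
    congr 1
    ext1 x
    rw [gradient_add (hφ1'.differentiable one_ne_zero) (hψ1'.differentiable one_ne_zero)]
    simp only [Pi.add_apply, Pi.sub_apply]
    abel

/-- A function supported in a compact set which small translations in a fixed direction push into
`Ω` is a limit of test functions on `Ω`. -/
lemma IsH1Supported.isH1Limit_of_translate {Ω A : Set Plane} (hΩ : IsOpen Ω) (hA : IsCompact A)
    {q : Plane → ℝ} {G : Plane → Plane} (h : IsH1Supported A q G) {e : Plane} {t₀ : ℝ}
    (ht₀ : 0 < t₀) (he : ∀ y ∈ A, ∀ t, 0 < t → t < t₀ → y + t • e ∈ Ω) : IsH1Limit Ω q G := by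
  intro ε hε
  obtain ⟨δ₁, hδ₁, H₁⟩ := exists_eLpNorm_translate_sub_le h.memLp hε
  obtain ⟨δ₂, hδ₂, H₂⟩ := exists_eLpNorm_translate_sub_le h.memLp_grad hε
  set δ := min δ₁ δ₂ with hδ
  have hδ0 : 0 < δ := lt_min hδ₁ hδ₂
  obtain ⟨t, ht0, htt, hte⟩ : ∃ t : ℝ, 0 < t ∧ t < t₀ ∧ t * ‖e‖ < δ / 2 := by
    have hc : Tendsto (fun t : ℝ => t * ‖e‖) (𝓝[>] 0) (𝓝 0) := by
      have : Tendsto (fun t : ℝ => t * ‖e‖) (𝓝 0) (𝓝 (0 * ‖e‖)) :=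
        (continuous_id.mul continuous_const).tendsto 0
      rw [zero_mul] at this
      exact this.mono_left nhdsWithin_le_nhds
    obtain ⟨t, h1, h2⟩ := ((hc.eventually (gt_mem_nhds (half_pos hδ0))).and
      (Ioo_mem_nhdsGT ht₀)).exists
    exact ⟨t, h2.1, h2.2, h1⟩
  set K := (fun y => y + t • e) '' A with hK
  have hKc : IsCompact K := hA.image (by fun_prop)
  have hKΩ : K ⊆ Ω := by
    rintro _ ⟨y, hy, rfl⟩
    exact he y hy t ht0 htt
  obtain ⟨s, hs, hsΩ⟩ := hKc.exists_cthickening_subset_open hΩ hKΩ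
  -- The kernel is centred at `t • e`, so mollifying also pushes the support into `Ω`. The bound `σ
  -- ≤ s` keeps the support inside `Ω`; `σ ≤ δ / 2` with `t * ‖e‖ < δ / 2` keeps every averaged
  -- translation shorter than `δ`.
  set σ := min s (δ / 2) with hσ
  have hσ0 : 0 < σ := lt_min hs (half_pos hδ0)
  let b : ContDiffBump (t • e) := ⟨σ / 2, σ, half_pos hσ0, half_lt_self hσ0⟩
  set ρ := b.normed volume with hρ
  have hρs : ContDiff ℝ ∞ ρ := b.contDiff_normed
  have hρc : HasCompactSupport ρ := b.hasCompactSupport_normed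
  have hsupp : ∀ z, ρ z ≠ 0 → dist z (t • e) < σ := fun z hz => by
    have : z ∈ Function.support ρ := hz
    rw [hρ, b.support_normed_eq] at this
    exact this
  have hnorm : ∀ z, ρ z ≠ 0 → ‖z‖ < δ := fun z hz => by
    have h1 := hsupp z hz
    rw [dist_eq_norm] at h1
    have h2 : ‖z‖ ≤ ‖z - t • e‖ + ‖t • e‖ := by simpa using norm_add_le (z - t • e) (t • e)
    rw [norm_smul, Real.norm_of_nonneg ht0.le] at h2
    have h3 : σ ≤ δ / 2 := min_le_right _ _
    linarith
  have hsub : tsupport (mollify ρ q) ⊆ Metric.cthickening s K := by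
    refine closure_minimal (fun x hx => ?_) Metric.isClosed_cthickening
    obtain ⟨y, hy⟩ : ∃ y, ρ (x - y) • q y ≠ 0 := by
      by_contra! hcon
      exact hx (by simp only [mollify, hcon, integral_zero])
    have hyA : y ∈ A := by
      by_contra hyA
      exact hy (by rw [h.eq_zero y hyA, smul_zero])
    have hρy : ρ (x - y) ≠ 0 := fun h0 => hy (by rw [h0, zero_smul])
    refine Metric.mem_cthickening_of_dist_le x (y + t • e) s K ⟨y, hyA, rfl⟩ ?_
    have := hsupp _ hρy
    rw [dist_eq_norm] at this ⊢
    rw [show x - (y + t • e) = x - y - t • e by abel]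
    exact this.le.trans (min_le_left _ _)
  refine ⟨mollify ρ q, ⟨contDiff_mollify hρs hρc h.memLp, ?_, hsub.trans hsΩ⟩, ?_, ?_⟩
  · exact hKc.cthickening.of_isClosed_subset (isClosed_tsupport _) hsub
  · exact eLpNorm_average_sub_le h.memLp b.continuous_normed hρc b.nonneg_normed
      b.integral_normed fun z hz => H₁ z ((hnorm z hz).trans_le (min_le_left _ _))
  · simp_rw [gradient_mollify hρs hρc h.memLp h.weak]
    exact eLpNorm_average_sub_le h.memLp_grad b.continuous_normed hρc b.nonneg_normed
      b.integral_normed fun z hz => H₂ z ((hnorm z hz).trans_le (min_le_right _ _))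

/-- Near every point of its closure, a Lipschitz domain absorbs small translations of its closure in
a suitable direction. -/
lemma IsLipschitzDomain.exists_translate {Ω : Set Plane} (hΩ : IsLipschitzDomain Ω) {x : Plane}
    (hx : x ∈ closure Ω) : ∃ r > 0, ∃ e : Plane, ∃ t₀ > 0,
      ∀ y ∈ closure Ω ∩ Metric.closedBall x r, ∀ t : ℝ, 0 < t → t < t₀ → y + t • e ∈ Ω := by
  by_cases hxΩ : x ∈ Ω
  · obtain ⟨r, hr, hsub⟩ := Metric.nhds_basis_closedBall.mem_iff.1 (hΩ.isOpen.mem_nhds hxΩ)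
    exact ⟨r, hr, 0, 1, one_pos, fun y hy t _ _ => by simpa using hsub hy.2⟩
  obtain ⟨r, hr, R, γ, C, hγ, hiff⟩ := hΩ.isGraph x (by
    rw [hΩ.isOpen.frontier_eq]
    exact ⟨hx, hxΩ⟩)
  -- The direction is the upward unit vector of the graph coordinates. Halving `r` keeps translated
  -- points in the ball where the graph description holds.
  refine ⟨r / 2, half_pos hr, R.symm (EuclideanSpace.single 1 1), r / 2, half_pos hr, ?_⟩
  rintro y ⟨hycl, hyb⟩ t ht0 htr
  rw [Metric.mem_closedBall] at hyb
  -- Passing to the closure loses strictness, which the upward translation restores.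
  have hgraph : γ (R y 0) ≤ R y 1 := by
    have hcl : IsClosed {z : Plane | γ (R z 0) ≤ R z 1} := by
      have := hγ.continuous
      exact isClosed_le (by fun_prop) (by fun_prop)
    have hy' : y ∈ closure (Metric.ball x r ∩ Ω) :=
      Metric.isOpen_ball.inter_closure ⟨Metric.mem_ball.2 (by linarith), hycl⟩
    exact closure_minimal (fun z hz => ((hiff z hz.1).1 hz.2).le) hcl hy'
  refine (hiff _ ?_).2 ?_
  · rw [Metric.mem_ball]
    calc dist (y + t • R.symm (EuclideanSpace.single 1 1)) x
        ≤ dist (y + t • R.symm (EuclideanSpace.single 1 1)) y + dist y x := dist_triangle _ _ _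
      _ = t + dist y x := by simp [norm_smul, abs_of_pos ht0]
      _ < r := by linarith
  · simp only [map_add, map_smul, LinearIsometryEquiv.apply_symm_apply, PiLp.add_apply,
      PiLp.smul_apply, PiLp.single_apply, smul_eq_mul]
    norm_num
    linarith

/-- A function in `H¹(ℝ²)` that vanishes outside a Lipschitz domain is a limit of test functions on
the domain. -/
lemma IsLipschitzDomain.isH1Limit {Ω : Set Plane} (hΩ : IsLipschitzDomain Ω) {q : Plane → ℝ}
    {G : Plane → Plane} (h : IsH1Supported Ω q G) : IsH1Limit Ω q G := by
  choose! r hr e t₀ ht₀ H using fun x (hx : x ∈ closure Ω) => hΩ.exists_translate hx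
  obtain ⟨T, hT, hcov⟩ := hΩ.isBounded.isCompact_closure.elim_nhds_subcover
    (fun x => Metric.ball x (r x / 2))
    (fun x hx => Metric.ball_mem_nhds x (half_pos (hr x hx)))
  -- Induction on the balls replaces a partition of unity. Split `q` as `θ q + (1 - θ) q`, with `θ`
  -- equal to one on the ball being removed: the first part is handled by translation, and the
  -- second vanishes off the remaining balls.
  have main : ∀ S : Finset Plane, (∀ x ∈ S, x ∈ closure Ω) → ∀ q G, IsH1Supported Ω q G →
      (∀ x, (∀ i ∈ S, x ∉ Metric.ball i (r i / 2)) → q x = 0 ∧ G x = 0) → IsH1Limit Ω q G := by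
    classical
    intro S
    induction S using Finset.induction_on with
    | empty =>
      intro _ q G _ h0 ε hε
      have hq : q = fun _ => 0 := funext fun x => (h0 x (by simp)).1
      have hG : G = fun _ => 0 := funext fun x => (h0 x (by simp)).2
      have hgr : gradient (fun _ : Plane => (0 : ℝ)) = fun _ => 0 := by
        ext1 x
        simp [gradient]
      refine ⟨fun _ => 0, ⟨contDiff_const, HasCompactSupport.zero, ?_⟩, ?_, ?_⟩
      · intro x hx
        simp [tsupport] at hx
      · simp [hq]
      · simp [hG, hgr]
    | insert i S hi ih =>
      intro hS q G hqG h0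
      have hicl := hS i (Finset.mem_insert_self _ _)
      have hri := hr i hicl
      let θ : ContDiffBump i := ⟨r i / 2, r i, half_pos hri, half_lt_self hri⟩
      have hθ : ContDiff ℝ ∞ (θ : Plane → ℝ) := θ.contDiff
      have hθ1 : Differentiable ℝ (θ : Plane → ℝ) := hθ.differentiable (by simp)
      have hη : ContDiff ℝ ∞ (fun x => 1 - θ x) := contDiff_const.sub hθ
      have hgη : ∀ x, gradient (fun x => 1 - θ x) x = - gradient θ x := fun x => by
        rw [gradient_sub (differentiable_const _) hθ1]
        simp [gradient]
      have hsplit₁ := hqG.mul hΩ.isBounded hθ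
      have hsplit₂ := hqG.mul hΩ.isBounded hη
      have hlim₁ : IsH1Limit Ω (fun x => θ x * q x) (fun x => θ x • G x + q x • gradient θ x) := by
        refine IsH1Supported.isH1Limit_of_translate (A := closure Ω ∩ Metric.closedBall i (r i))
          hΩ.isOpen (hΩ.isBounded.isCompact_closure.inter_right Metric.isClosed_closedBall)
          ⟨hsplit₁.memLp, hsplit₁.memLp_grad, hsplit₁.weak, ?_, ?_⟩ (ht₀ i hicl) (H i hicl)
        · intro x hx
          by_cases hxΩ : x ∈ Ω
          · have hxb : x ∉ tsupport θ := by
              rw [θ.tsupport_eq]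
              exact fun hxb => hx ⟨subset_closure hxΩ, hxb⟩
            simp [image_eq_zero_of_notMem_tsupport hxb]
          · exact hsplit₁.eq_zero x hxΩ
        · intro x hx
          by_cases hxΩ : x ∈ Ω
          · have hxb : x ∉ tsupport θ := by
              rw [θ.tsupport_eq]
              exact fun hxb => hx ⟨subset_closure hxΩ, hxb⟩
            simp [image_eq_zero_of_notMem_tsupport hxb, gradient_eq_zero_of_notMem_tsupport hxb]
          · exact hsplit₁.grad_eq_zero x hxΩ
      have hlim₂ := ih (fun x hx => hS x (Finset.mem_insert_of_mem hx)) _ _ hsplit₂ (by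
        intro x hx
        by_cases hxi : x ∈ Metric.ball i (r i / 2)
        · have h1 : θ x = 1 := θ.one_of_mem_closedBall (Metric.ball_subset_closedBall hxi)
          have h2 : gradient θ x = 0 := by
            have : (θ : Plane → ℝ) =ᶠ[𝓝 x] fun _ => 1 := by
              filter_upwards [Metric.isOpen_ball.mem_nhds hxi] with y hy
              exact θ.one_of_mem_closedBall (Metric.ball_subset_closedBall hy)
            simp [gradient, this.fderiv_eq]
          simp [hgη, h1, h2]
        · have := h0 x (fun k hk => by
            rcases Finset.mem_insert.1 hk with rfl | hk
            · exact hxi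
            · exact hx k hk)
          simp [this.1, this.2])
      have := hlim₁.add hlim₂ hsplit₁.memLp hsplit₂.memLp hsplit₁.memLp_grad hsplit₂.memLp_grad
      convert! this using 1
      · ext x
        ring
      · ext1 x
        rw [hgη, sub_smul, one_smul, smul_neg]
        abel
  refine main T hT q G h fun x hx => ?_
  have hxΩ : x ∉ Ω := fun hxΩ => by
    obtain ⟨i, hi, hxi⟩ := Set.mem_iUnion₂.1 (hcov (subset_closure hxΩ))
    exact hx i hi hxi
  exact ⟨h.eq_zero x hxΩ, h.grad_eq_zero x hxΩ⟩

/-! ### Weak gradients -/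

lemma MemH1.isWeakGrad_weakGrad {U : Set Plane} {p : Plane → ℝ} (hp : MemH1 U p) :
    IsWeakGrad U p (weakGrad U p) := by
  have h := hp.2
  rw [weakGrad, dif_pos h]
  exact h.choose_spec

lemma MemL2.mono_set {F : Type} [NormedAddCommGroup F] {U V : Set Plane} {v : Plane → F}
    (hv : MemL2 V v) (h : U ⊆ V) : MemL2 U v :=
  hv.mono_measure (Measure.restrict_mono h le_rfl)

/-- Weak gradients are unique. -/
lemma IsWeakGrad.ae_eq {U : Set Plane} (hU : IsOpen U) (hb : Bornology.IsBounded U)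
    {p : Plane → ℝ} {G H : Plane → Plane} (hG : IsWeakGrad U p G) (hH : IsWeakGrad U p H) :
    G =ᵐ[volume.restrict U] H := by
  have : IsFiniteMeasure (volume.restrict U) := isFiniteMeasure_restrict.2 hb.measure_lt_top.ne
  have hi : IntegrableOn (fun x => G x - H x) U := (hG.1.sub hH.1).integrable one_le_two
  have key := hU.ae_eq_zero_of_integral_contDiff_smul_eq_zero (μ := volume)
    hi.locallyIntegrableOn (fun φ hφs hφc hφU => by
      have hφL : MemL2 U φ := memL2_of_continuous hb hφs.continuous
      have h1 := hG.2 φ ⟨hφs, hφc, hφU⟩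
      have h2 := hH.2 φ ⟨hφs, hφc, hφU⟩
      rw [← setIntegral_eq_integral_of_forall_compl_eq_zero (s := U) (fun x hx => by
        rw [image_eq_zero_of_notMem_tsupport (fun h => hx (hφU h)), zero_smul])]
      simp_rw [smul_sub]
      rw [integral_sub (integrable_smul_of_memLp_two hφL hG.1)
        (integrable_smul_of_memLp_two hφL hH.1), sub_eq_zero]
      exact neg_injective (h1.symm.trans h2))
  filter_upwards [(ae_restrict_iff' hU.measurableSet).2 key] with x hx
  exact sub_eq_zero.1 hx

lemma IsWeakGrad.congr {U : Set Plane} {p p' : Plane → ℝ} {G : Plane → Plane}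
    (h : IsWeakGrad U p G) (hp : p =ᵐ[volume.restrict U] p') : IsWeakGrad U p' G := by
  refine ⟨h.1, fun φ hφ => ?_⟩
  rw [← h.2 φ hφ]
  refine integral_congr_ae ?_
  filter_upwards [hp] with x hx
  rw [hx]

lemma IsWeakGrad.add {U : Set Plane} (hb : Bornology.IsBounded U) {p q : Plane → ℝ}
    {G H : Plane → Plane} (hp : MemL2 U p) (hq : MemL2 U q) (hG : IsWeakGrad U p G)
    (hH : IsWeakGrad U q H) : IsWeakGrad U (fun x => p x + q x) (fun x => G x + H x) := by
  refine ⟨hG.1.add hH.1, fun φ hφ => ?_⟩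
  have hφ1 : ContDiff ℝ 1 φ := hφ.1.of_le (by simp)
  have hφL : MemL2 U φ := memL2_of_continuous hb hφ1.continuous
  have hgL : MemL2 U (gradient φ) := memL2_of_continuous hb (continuous_gradient hφ1)
  simp_rw [add_smul, smul_add]
  rw [integral_add (integrable_smul_of_memLp_two hp hgL) (integrable_smul_of_memLp_two hq hgL),
    integral_add (integrable_smul_of_memLp_two hφL hG.1)
      (integrable_smul_of_memLp_two hφL hH.1), hG.2 φ hφ, hH.2 φ hφ, neg_add]

/-- Since `q` and `G` vanish off `A`, integrals over `A` and over the plane agree. -/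
lemma IsH1Supported.isWeakGrad {A : Set Plane} {q : Plane → ℝ} {G : Plane → Plane}
    (h : IsH1Supported A q G) : IsWeakGrad A q G := by
  refine ⟨h.memLp_grad.restrict A, fun φ hφ => ?_⟩
  have := h.weak.2 φ ⟨hφ.1, hφ.2.1, Set.subset_univ _⟩
  simp only [Measure.restrict_univ] at this
  rw [setIntegral_eq_integral_of_forall_compl_eq_zero (fun x hx => by
      rw [h.eq_zero x hx, zero_smul]), this,
    setIntegral_eq_integral_of_forall_compl_eq_zero (fun x hx => by
      rw [h.grad_eq_zero x hx, smul_zero])]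

lemma IsH1Supported.sum {ι : Type*} {A : Set Plane} (s : Finset ι) {q : ι → Plane → ℝ}
    {G : ι → Plane → Plane} (h : ∀ i ∈ s, IsH1Supported A (q i) (G i)) :
    IsH1Supported A (fun x => ∑ i ∈ s, q i x) (fun x => ∑ i ∈ s, G i x) := by
  have m1 : MemLp (fun x => ∑ i ∈ s, q i x) 2 volume :=
    memLp_finsetSum s fun i hi => (h i hi).memLp
  have m2 : MemLp (fun x => ∑ i ∈ s, G i x) 2 volume :=
    memLp_finsetSum s fun i hi => (h i hi).memLp_grad
  refine ⟨m1, m2, ⟨?_, fun φ hφ => ?_⟩, fun x hx => ?_, fun x hx => ?_⟩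
  · exact m2.restrict _
  · have hφ1 : ContDiff ℝ 1 φ := hφ.1.of_le (by simp)
    have hφL : MemLp φ 2 volume := hφ1.continuous.memLp_of_hasCompactSupport hφ.2.1
    have hgL : MemLp (gradient φ) 2 volume :=
      (continuous_gradient hφ1).memLp_of_hasCompactSupport (hasCompactSupport_gradient hφ.2.1)
    simp_rw [Finset.sum_smul, Finset.smul_sum]
    simp only [Measure.restrict_univ]
    rw [integral_finsetSum _ fun i hi => integrable_smul_of_memLp_two (h i hi).memLp hgL,
      integral_finsetSum _ fun i hi => integrable_smul_of_memLp_two hφL (h i hi).memLp_grad,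
      ← Finset.sum_neg_distrib]
    refine Finset.sum_congr rfl fun i hi => ?_
    simpa only [Measure.restrict_univ] using (h i hi).weak.2 φ hφ
  · exact Finset.sum_eq_zero fun i hi => (h i hi).eq_zero x hx
  · exact Finset.sum_eq_zero fun i hi => (h i hi).grad_eq_zero x hx

/-! ### Polygonal partitions -/

/-- A segment spans an affine subspace of dimension at most one, hence a proper one. -/
lemma volume_segment (a b : Plane) : volume (segment ℝ a b) = 0 := by
  refine measure_mono_null ?_ (Measure.addHaar_affineSubspace volume (affineSpan ℝ {a, b}) ?_)
  · rw [← convexHull_pair]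
    exact convexHull_subset_affineSpan _
  · intro htop
    have h1 := collinear_iff_finrank_le_one.1 (collinear_pair ℝ a b)
    rw [← direction_affineSpan, htop, AffineSubspace.direction_top, finrank_top,
      finrank_euclideanSpace, Fintype.card_fin] at h1
    omega

lemma IsPolygonalDomain.volume_frontier {U : Set Plane} (hU : IsPolygonalDomain U) :
    volume (frontier U) = 0 := by
  obtain ⟨s, hs⟩ := hU.frontier_eq
  rw [hs]
  exact (measure_biUnion_null_iff s.countable_toSet).2 fun e _ => volume_segment _ _

section Partition

variable {Ω : Set Plane} {n : ℕ} {Ωs : Fin n → Set Plane}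

/-- Up to a null set, the domain is the union of the subdomains. -/
lemma IsPolygonalPartition.restrict_eq (h : IsPolygonalPartition Ω Ωs) :
    (volume.restrict Ω : Measure Plane) = volume.restrict (⋃ i, Ωs i) := by
  refine Measure.restrict_congr_set (Filter.EventuallyLE.antisymm ?_ ?_)
  · have hnull : volume (⋃ i, frontier (Ωs i)) = 0 :=
      measure_iUnion_null fun i => (h.polygonal i).volume_frontier
    filter_upwards [measure_eq_zero_iff_ae_notMem.1 hnull] with x hx hxΩ
    have hxcl : x ∈ closure Ω := subset_closure hxΩ
    rw [h.closure_eq] at hxcl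
    obtain ⟨i, hi⟩ := Set.mem_iUnion.1 hxcl
    refine Set.mem_iUnion.2 ⟨i, ?_⟩
    by_contra hxi
    refine hx (Set.mem_iUnion.2 ⟨i, ?_⟩)
    rw [(h.polygonal i).isOpen.frontier_eq]
    exact ⟨hi, hxi⟩
  · exact Eventually.of_forall (Set.iUnion_subset h.subset)

/-- A boundary point of `Ω` is in the closure of some subdomain but not in that subdomain, which
lies inside the open set `Ω`. Traces on the skeleton therefore restrict to `∂Ω`. -/
lemma IsPolygonalPartition.frontier_subset (h : IsPolygonalPartition Ω Ωs) (hΩ : IsOpen Ω) :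
    frontier Ω ⊆ skeleton Ωs := by
  intro x hx
  rw [hΩ.frontier_eq, h.closure_eq] at hx
  obtain ⟨i, hi⟩ := Set.mem_iUnion.1 hx.1
  refine Set.mem_iUnion.2 ⟨i, ?_⟩
  rw [(h.polygonal i).isOpen.frontier_eq]
  exact ⟨hi, fun h' => hx.2 (h.subset i h')⟩

lemma IsPolygonalPartition.ae_of_forall (h : IsPolygonalPartition Ω Ωs) {P : Plane → Prop}
    (hP : ∀ i, ∀ x ∈ Ωs i, P x) : ∀ᵐ x ∂(volume.restrict Ω), P x := by
  rw [h.restrict_eq, ae_restrict_iUnion_iff]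
  exact fun i => (ae_restrict_iff' (h.polygonal i).isOpen.measurableSet).2
    (Eventually.of_forall (hP i))

lemma IsPolygonalPartition.setIntegral_eq_sum (h : IsPolygonalPartition Ω Ωs) {F : Plane → ℝ}
    (hF : ∀ i, IntegrableOn F (Ωs i)) : ∫ x in Ω, F x = ∑ i, ∫ x in Ωs i, F x := by
  rw [h.restrict_eq]
  exact integral_iUnion_fintype (fun i => (h.polygonal i).isOpen.measurableSet) h.disjoint hF

lemma sum_indicator_of_mem {F : Type*} [AddCommMonoid F]
    (hd : Pairwise fun i j => Disjoint (Ωs i) (Ωs j)) (v : Fin n → Plane → F) {i : Fin n}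
    {x : Plane} (hx : x ∈ Ωs i) : ∑ j, (Ωs j).indicator (v j) x = v i x := by
  rw [Finset.sum_eq_single i]
  · exact Set.indicator_of_mem hx _
  · intro j _ hj
    exact Set.indicator_of_notMem (fun hxj => (Set.disjoint_left.1 (hd hj)) hxj hx) _
  · simp

lemma memLp_glue {F : Type} [NormedAddCommGroup F] (h : ∀ i, MeasurableSet (Ωs i))
    {v : Fin n → Plane → F} (hv : ∀ i, MemL2 (Ωs i) (v i)) : MemLp (glue Ωs v) 2 volume :=
  memLp_finsetSum _ fun i _ => (memLp_indicator_iff_restrict (h i)).2 (hv i)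

end Partition

/-! ### The glued solution -/

lemma integrable_inner_of_memLp_two {α : Type*} [MeasurableSpace α] {μ : Measure α}
    {u v : α → Plane} (hu : MemLp u 2 μ) (hv : MemLp v 2 μ) :
    Integrable (fun x => inner ℝ (u x) (v x)) μ := by
  refine (hu.norm.integrable_mul hv.norm).mono'
    (hu.aestronglyMeasurable.inner hv.aestronglyMeasurable) (Eventually.of_forall fun x => ?_)
  exact norm_inner_le_norm _ _

lemma IsDiffusionTensor.memL2 {Ω U : Set Plane} {K : Plane → Matrix (Fin 2) (Fin 2) ℝ}
    (hK : IsDiffusionTensor Ω K) (hU : U ⊆ Ω) {v : Plane → Plane} (hv : MemL2 U v) :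
    MemL2 U (fun x => Matrix.toEuclideanLin (K x) (v x)) := by
  refine MemLp.of_eval_piLp fun i => ?_
  have hi : ∀ j, MemLp (fun x => K x i j * v x j) 2 (volume.restrict U) := fun j =>
    (hv.eval_piLp j).mul ((hK.1 i j).mono_measure (Measure.restrict_mono hU le_rfl))
  have := memLp_finsetSum Finset.univ fun j _ => hi j
  simpa only [Matrix.toLpLin_apply, Matrix.mulVec, dotProduct] using this

lemma tendsto_eLpNorm_add {α E : Type*} [MeasurableSpace α] {μ : Measure α}
    [NormedAddCommGroup E] {a b : ℕ → α → E} (ha : ∀ k, AEStronglyMeasurable (a k) μ)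
    (hb : ∀ k, AEStronglyMeasurable (b k) μ)
    (ha0 : Tendsto (fun k => eLpNorm (a k) 2 μ) atTop (𝓝 0))
    (hb0 : Tendsto (fun k => eLpNorm (b k) 2 μ) atTop (𝓝 0)) :
    Tendsto (fun k => eLpNorm (fun x => a k x + b k x) 2 μ) atTop (𝓝 0) := by
  have h0 := ha0.add hb0
  rw [add_zero] at h0
  exact tendsto_of_tendsto_of_tendsto_of_le_of_le tendsto_const_nhds h0 (fun _ => zero_le)
    fun k => eLpNorm_add_le (ha k) (hb k) one_le_two

lemma tendsto_eLpNorm_sub {α E : Type*} [MeasurableSpace α] {μ : Measure α}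
    [NormedAddCommGroup E] {a b : ℕ → α → E} (ha : ∀ k, AEStronglyMeasurable (a k) μ)
    (hb : ∀ k, AEStronglyMeasurable (b k) μ)
    (ha0 : Tendsto (fun k => eLpNorm (a k) 2 μ) atTop (𝓝 0))
    (hb0 : Tendsto (fun k => eLpNorm (b k) 2 μ) atTop (𝓝 0)) :
    Tendsto (fun k => eLpNorm (fun x => a k x - b k x) 2 μ) atTop (𝓝 0) := by
  have h0 := ha0.add hb0
  rw [add_zero] at h0
  exact tendsto_of_tendsto_of_tendsto_of_le_of_le tendsto_const_nhds h0 (fun _ => zero_le)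
    fun k => eLpNorm_sub_le (ha k) (hb k) one_le_two

lemma tendsto_eLpNorm_mono_measure {α E : Type*} [MeasurableSpace α] {μ ν : Measure α}
    [NormedAddCommGroup E] {a : ℕ → α → E} (hμν : μ ≤ ν)
    (h : Tendsto (fun k => eLpNorm (a k) 2 ν) atTop (𝓝 0)) :
    Tendsto (fun k => eLpNorm (a k) 2 μ) atTop (𝓝 0) :=
  tendsto_of_tendsto_of_tendsto_of_le_of_le tendsto_const_nhds h (fun _ => zero_le)
    fun _ => eLpNorm_mono_measure _ hμν

/-- Two functions with the same trace on the boundary of a polygonal subdomain differ by a function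
whose extension by zero lies in `H¹(ℝ²)`. -/
lemma isH1Supported_indicator_sub {Ω U Γ : Set Plane} (hU : IsPolygonalDomain U) (hUΩ : U ⊆ Ω)
    (hΓ : frontier U ⊆ Γ) {p w t : Plane → ℝ} (hp : HasTrace U (frontier U) p t)
    (hw : HasTrace Ω Γ w t) :
    IsH1Supported U (U.indicator fun x => p x - w x)
      (U.indicator fun x => weakGrad U p x - weakGrad Ω w x) := by
  obtain ⟨hpH, htU, φ, hφ, ⟨hφ0, hφ1⟩, hφt⟩ := hp
  obtain ⟨hwH, htΓ, ψ, hψ, ⟨hψ0, hψ1⟩, hψt⟩ := hw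
  have hle : (volume.restrict U : Measure Plane) ≤ volume.restrict Ω :=
    Measure.restrict_mono hUΩ le_rfl
  have hwU : MemL2 U w := MemL2.mono_set hwH.1 hUΩ
  have hgp := hpH.isWeakGrad_weakGrad.1
  have hgw : MemL2 U (weakGrad Ω w) := MemL2.mono_set hwH.isWeakGrad_weakGrad.1 hUΩ
  have hφc : ∀ k, ContDiff ℝ 1 (φ k) := fun k => (hφ k).of_le (by simp)
  have hψc : ∀ k, ContDiff ℝ 1 (ψ k) := fun k => (hψ k).of_le (by simp)
  have hq : MemL2 U (fun x => p x - w x) := hpH.1.sub hwU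
  have hG : MemL2 U (fun x => weakGrad U p x - weakGrad Ω w x) := hgp.sub hgw
  have hUm := hU.isOpen.measurableSet
  refine ⟨(memLp_indicator_iff_restrict hUm).2 hq, (memLp_indicator_iff_restrict hUm).2 hG, ?_,
    fun x hx => Set.indicator_of_notMem hx _, fun x hx => Set.indicator_of_notMem hx _⟩
  -- Both sequences of smooth approximants have boundary values tending to `t`, so those of their
  -- differences tend to zero.
  refine isWeakGrad_univ_indicator hU hq hG (h := fun k x => φ k x - ψ k x)
    (fun k => (hφ k).sub (hψ k)) ?_ ?_ ?_
  · have := tendsto_eLpNorm_sub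
      (fun k => (hφc k).continuous.aestronglyMeasurable.sub hpH.1.aestronglyMeasurable)
      (fun k => (hψc k).continuous.aestronglyMeasurable.sub hwU.aestronglyMeasurable)
      hφ0 (tendsto_eLpNorm_mono_measure hle hψ0)
    refine this.congr fun k => ?_
    congr 1
    ext x
    simp only [Pi.sub_apply]
    ring
  · have := tendsto_eLpNorm_sub
      (fun k => (continuous_gradient (hφc k)).aestronglyMeasurable.sub hgp.aestronglyMeasurable)
      (fun k => (continuous_gradient (hψc k)).aestronglyMeasurable.sub hgw.aestronglyMeasurable)
      hφ1 (tendsto_eLpNorm_mono_measure hle hψ1)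
    refine this.congr fun k => ?_
    congr 1
    ext1 x
    rw [gradient_sub ((hφc k).differentiable one_ne_zero) ((hψc k).differentiable one_ne_zero)]
    simp only [Pi.sub_apply]
    abel
  · have := tendsto_eLpNorm_sub
      (fun k => (hφc k).continuous.aestronglyMeasurable.sub htU.aestronglyMeasurable)
      (fun k => (hψc k).continuous.aestronglyMeasurable.sub htU.aestronglyMeasurable)
      hφt (tendsto_eLpNorm_mono_measure (Measure.restrict_mono hΓ le_rfl) hψt)
    refine this.congr fun k => ?_
    congr 1
    ext x
    simp only [Pi.sub_apply]
    ring

/-- Adding a limit of test functions on `Ω` to a function in `H¹(Ω)` does not change its trace on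
the boundary. -/
lemma HasTrace.add_isH1Limit {Ω Γ : Set Plane} (hΩ : IsOpen Ω) (hb : Bornology.IsBounded Ω)
    (hΓ : frontier Ω ⊆ Γ) {w t g p q : Plane → ℝ} {G : Plane → Plane} (hw : HasTrace Ω Γ w t)
    (htg : t =ᵐ[(Measure.hausdorffMeasure 1).restrict (frontier Ω)] g)
    (hqG : IsH1Supported Ω q G) (hlim : IsH1Limit Ω q G)
    (hp : (fun x => w x + q x) =ᵐ[volume.restrict Ω] p) : HasTrace Ω (frontier Ω) p g := by
  obtain ⟨hwH, htΓ, ψ, hψ, ⟨hψ0, hψ1⟩, hψt⟩ := hw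
  have hqL : MemL2 Ω q := hqG.memLp.restrict Ω
  have hGL : MemL2 Ω G := hqG.memLp_grad.restrict Ω
  have hgw := hwH.isWeakGrad_weakGrad
  have hweak : IsWeakGrad Ω p (fun x => weakGrad Ω w x + G x) :=
    (hgw.add hb hwH.1 hqL hqG.isWeakGrad).congr hp
  have hpH : MemH1 Ω p := ⟨(memLp_congr_ae hp).1 (hwH.1.add hqL), _, hweak⟩
  have hgrad := hpH.isWeakGrad_weakGrad.ae_eq hΩ hb hweak
  have hle : (Measure.hausdorffMeasure 1).restrict (frontier Ω) ≤
    (Measure.hausdorffMeasure 1 : Measure Plane).restrict Γ := Measure.restrict_mono hΓ le_rfl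
  have hpos : ∀ k : ℕ, ((k : ℝ≥0∞) + 1)⁻¹ ≠ 0 := fun k =>
    ENNReal.inv_ne_zero.2 (by finiteness)
  choose χ hχ hχ0 hχ1 using fun k : ℕ => hlim _ (hpos k)
  have hinv : Tendsto (fun k : ℕ => ((k : ℝ≥0∞) + 1)⁻¹) atTop (𝓝 0) := by
    have := (tendsto_add_atTop_iff_nat 1).2 ENNReal.tendsto_inv_nat_nhds_zero
    simpa using this
  have hψc : ∀ k, ContDiff ℝ 1 (ψ k) := fun k => (hψ k).of_le (by simp)
  have hχc : ∀ k, ContDiff ℝ 1 (χ k) := fun k => (hχ k).1.of_le (by simp)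
  have hχ0' : Tendsto (fun k => eLpNorm (fun x => χ k x - q x) 2 (volume.restrict Ω)) atTop
      (𝓝 0) :=
    tendsto_eLpNorm_mono_measure Measure.restrict_le_self
      (tendsto_of_tendsto_of_tendsto_of_le_of_le tendsto_const_nhds hinv (fun _ => zero_le) hχ0)
  have hχ1' : Tendsto (fun k => eLpNorm (fun x => gradient (χ k) x - G x) 2 (volume.restrict Ω))
      atTop (𝓝 0) :=
    tendsto_eLpNorm_mono_measure Measure.restrict_le_self
      (tendsto_of_tendsto_of_tendsto_of_le_of_le tendsto_const_nhds hinv (fun _ => zero_le) hχ1)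
  -- The `χ k` are supported inside the open set `Ω`, so `ψ k + χ k` has the same values as `ψ k` on
  -- `frontier Ω`.
  refine ⟨hpH, (memLp_congr_ae htg).1 (htΓ.mono_measure hle), fun k x => ψ k x + χ k x,
    fun k => (hψ k).add (hχ k).1, ⟨?_, ?_⟩, ?_⟩
  · have := tendsto_eLpNorm_add
      (fun k => (hψc k).continuous.aestronglyMeasurable.sub hwH.1.aestronglyMeasurable)
      (fun k => (hχc k).continuous.aestronglyMeasurable.sub hqL.aestronglyMeasurable) hψ0 hχ0'
    refine this.congr fun k => eLpNorm_congr_ae ?_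
    filter_upwards [hp] with x hx
    rw [← hx]
    simp only [Pi.sub_apply]
    ring
  · have := tendsto_eLpNorm_add
      (fun k => (continuous_gradient (hψc k)).aestronglyMeasurable.sub hgw.1.aestronglyMeasurable)
      (fun k => (continuous_gradient (hχc k)).aestronglyMeasurable.sub hGL.aestronglyMeasurable)
      hψ1 hχ1'
    refine this.congr fun k => eLpNorm_congr_ae ?_
    filter_upwards [hgrad] with x hx
    rw [hx, gradient_add ((hψc k).differentiable one_ne_zero)
      ((hχc k).differentiable one_ne_zero)]
    simp only [Pi.sub_apply]
    abel
  · refine (tendsto_eLpNorm_mono_measure hle hψt).congr fun k => eLpNorm_congr_ae ?_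
    filter_upwards [htg, ae_restrict_mem isClosed_frontier.measurableSet] with x hx hxf
    rw [hΩ.frontier_eq] at hxf
    rw [hx, image_eq_zero_of_notMem_tsupport fun h => hxf.2 ((hχ k).2.2 h), add_zero]

/-- Local solutions whose pressures share their traces on the skeleton and whose fluxes are weakly
continuous glue to a solution of the global problem. -/
theorem solvesGlobal_glue {n : ℕ} (Ω : Set Plane) (Ωs : Fin n → Set Plane)
    (hΩ : IsLipschitzDomain Ω) (hΩs : IsPolygonalPartition Ω Ωs)
    (K : Plane → Matrix (Fin 2) (Fin 2) ℝ) (hK : IsDiffusionTensor Ω K)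
    (f g : Plane → ℝ)
    (u : Fin n → Plane → Plane) (p : Fin n → Plane → ℝ)
    (lam : Plane → ℝ) (hlam : MemMortarg Ω (skeleton Ωs) g lam)
    (hlocal : ∀ i, SolvesMixed (Ωs i) K f (u i) (p i))
    (htrace : ∀ i, HasTrace (Ωs i) (frontier (Ωs i)) (p i) lam)
    (hflux : ∀ w : Plane → ℝ, MemH10 Ω w →
      ∑ i, ipVec (Ωs i) (u i) (weakGrad Ω w) = ipScal Ω f w) :
    SolvesGlobal Ω K f g (glue Ωs u) (glue Ωs p) := by
  obtain ⟨⟨-, w, hwH, hw⟩, hlg⟩ := hlam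
  have hm : ∀ i, MeasurableSet (Ωs i) := fun i => (hΩs.polygonal i).isOpen.measurableSet
  have hq := IsH1Supported.sum Finset.univ fun i _ =>
    (isH1Supported_indicator_sub (hΩs.polygonal i) (hΩs.subset i)
      (Set.subset_iUnion (fun i => frontier (Ωs i)) i) (htrace i) hw).mono (hΩs.subset i)
  have hwL : MemL2 Ω w := hwH.1
  have hp : (fun x => w x + ∑ i, (Ωs i).indicator (fun x => p i x - w x) x)
      =ᵐ[volume.restrict Ω] glue Ωs p :=
    hΩs.ae_of_forall fun i x hx => by
      beta_reduce
      rw [glue, sum_indicator_of_mem hΩs.disjoint _ hx, sum_indicator_of_mem hΩs.disjoint _ hx,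
        add_sub_cancel]
  have htr : HasTrace Ω (frontier Ω) (glue Ωs p) g :=
    hw.add_isH1Limit hΩ.isOpen hΩ.isBounded (hΩs.frontier_subset hΩ.isOpen) hlg hq
      (hΩ.isH1Limit hq) hp
  have hpH : MemH1 Ω (glue Ωs p) := htr.1
  have hgrad := hpH.isWeakGrad_weakGrad.ae_eq hΩ.isOpen hΩ.isBounded
    ((hwH.isWeakGrad_weakGrad.add hΩ.isBounded hwL (hq.memLp.restrict Ω)
      hq.isWeakGrad).congr hp)
  -- On `Ωs i` the gradient of `w` plus that of the correction collapses to the gradient of `p i`,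
  -- so each local law can be read off from the global gradient.
  have hgradi : ∀ i, weakGrad Ω (glue Ωs p) =ᵐ[volume.restrict (Ωs i)] weakGrad (Ωs i) (p i) := by
    intro i
    filter_upwards [ae_restrict_of_ae_restrict_of_subset (hΩs.subset i) hgrad,
      ae_restrict_mem (hm i)] with x hx hxi
    rw [hx, sum_indicator_of_mem hΩs.disjoint _ hxi, add_sub_cancel]
  have hglue : ∀ i, glue Ωs u =ᵐ[volume.restrict (Ωs i)] u i := by
    intro i
    filter_upwards [ae_restrict_mem (hm i)] with x hxi
    exact sum_indicator_of_mem hΩs.disjoint _ hxi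
  have huL : MemL2 Ω (glue Ωs u) := (memLp_glue hm fun i => (hlocal i).flux_mem).restrict Ω
  have hsplit : ∀ a v : Plane → Plane, MemL2 Ω a → MemL2 Ω v →
      ipVec Ω a v = ∑ i, ipVec (Ωs i) a v := fun a v ha hv =>
    hΩs.setIntegral_eq_sum fun i =>
      integrable_inner_of_memLp_two (ha.mono_set (hΩs.subset i)) (hv.mono_set (hΩs.subset i))
  have hsplitu : ∀ v : Plane → Plane, MemL2 Ω v →
      ipVec Ω (glue Ωs u) v = ∑ i, ipVec (Ωs i) (u i) v := by
    intro v hv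
    rw [hsplit _ _ huL hv]
    refine Finset.sum_congr rfl fun i _ => integral_congr_ae ?_
    filter_upwards [hglue i] with x hx
    rw [hx]
  refine ⟨⟨hpH, htr⟩, huL, hpH, fun v hv => ?_, fun w' hw' => ?_⟩
  · rw [hsplitu v hv, hsplit _ v (hK.memL2 subset_rfl hpH.isWeakGrad_weakGrad.1) hv,
      ← Finset.sum_sub_distrib]
    refine Finset.sum_eq_zero fun i _ => ?_
    rw [← (hlocal i).constitutive v (hv.mono_set (hΩs.subset i))]
    congr 1
    refine integral_congr_ae ?_
    filter_upwards [hgradi i] with x hx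
    rw [hx]
  · rw [hsplitu _ hw'.1.isWeakGrad_weakGrad.1, hflux w' hw']

end Mortar

end

theorem mainTheorem6 {n : ℕ} (Ω : Set Mortar.Plane) (Ωs : Fin n → Set Mortar.Plane)
    (hΩ : Mortar.IsLipschitzDomain Ω) (hΩs : Mortar.IsPolygonalPartition Ω Ωs)
    (K : Mortar.Plane → Matrix (Fin 2) (Fin 2) ℝ) (hK : Mortar.IsDiffusionTensor Ω K)
    (f g : Mortar.Plane → ℝ) (hf : Mortar.MemL2 Ω f)
    (u : Fin n → Mortar.Plane → Mortar.Plane) (p : Fin n → Mortar.Plane → ℝ)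
    (lam : Mortar.Plane → ℝ) (hlam : Mortar.MemMortarg Ω (Mortar.skeleton Ωs) g lam)
    (hlocal : ∀ i, Mortar.SolvesMixed (Ωs i) K f (u i) (p i))
    (htrace : ∀ i, Mortar.HasTrace (Ωs i) (frontier (Ωs i)) (p i) lam)
    (hflux : ∀ w : Mortar.Plane → ℝ, Mortar.MemH10 Ω w →
      ∑ i, Mortar.ipVec (Ωs i) (u i) (Mortar.weakGrad Ω w) = Mortar.ipScal Ω f w) :
    Mortar.SolvesGlobal Ω K f g (Mortar.glue Ωs u) (Mortar.glue Ωs p) := by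
  exact Mortar.solvesGlobal_glue Ω Ωs hΩ hΩs K hK f g u p lam hlam hlocal htrace hflux
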